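/- Masses $m_1,\dots,m_4\ge 0$ (not all zero) at points $q_1,\dots,q_4\in\mathbb R^2$ satisfy the \emph{central configuration equations} if for some $\lambda>0$ and every $i$, $$\sum_{j\ne i} m_j\,\frac{q_j-q_i}{\|q_j-q_i\|^{3}}=-\lambda\,(q_i-\mathbf c),\qquad \mathbf c=\frac{\sum_j m_jq_j}{\sum_j m_j},$$ where terms with $m_j=0$ are zero. If the equations hold, all masses are positive and the points are distinct, $q$ is a \emph{central configuration} (CC) for these masses. If the equations hold, some but not all masses are zero, and only bodies of mass zero share a position, $q$ is a \emph{CC of the restricted problem}. A \emph{trapezoid} is a convex quadrilateral with at least one pair of parallel sides. Let $r_{ij}=\|q_i-q_j\|$ and $$D=(r_{13}^3-r_{12}^3)(r_{23}^3-r_{34}^3)(r_{24}^3-r_{14}^3)-(r_{12}^3-r_{14}^3)(r_{24}^3-r_{34}^3)(r_{13}^3-r_{23}^3).$$ **Theorem.** For $(a,b,c)\in\mathbb R^3$ put $q_1=(0,0)$, $q_2=(0,a)$, $q_3=(1,b)$, $q_4=(1,c)$, and let $$\Omega=\{(a,b,c)\in\mathbb R^3:\ a\ge 1,\ b>c,\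 D=0,\ r_{24}\ge r_{13}>r_{12}\ge r_{23}\ge r_{14}\ge r_{34}\}.$$ (i) $\Omega$ is the set of realizable trapezoid central configurations. Precisely, label the bodies so that $r_{12}$ is the longest of the sides $r_{12},r_{23},r_{34},r_{14}$, and $r_{23}\ge r_{14}$, $r_{24}\ge r_{13}$. Then $\Omega$ is the set of all $(a,b,c)$ with $a\ge1$, $b>c$ that obey this labelling convention and for which $q$ is a CC for some positive masses with $m_1=1$. Moreover, every four-body CC with positive masses at the vertices of a trapezoid becomes, after relabelling the bodies and applying a similarity of the plane, the configuration of a point of $\Omega$. (ii) The boundary of $\Omega$ in the surface $\{D=0\}\subset\mathbb R^3$ (that is, its topological boundary relative to this subspace) is $\mathcal C_1\cup\mathcal C_2\cup\mathcal C_3\cup\{P_1,P_2,P_3\}$, where \begin{align*} \mathcal C_1&=\{(2/\sqrt3,\,1/\sqrt3,\,c): c\in(-1/\sqrt3,1/\sqrt3)\},\\ \mathcal C_2&=\{(\sqrt{1+c^2},\,c+\sqrt{1+c^2},\,c): c\in(-1/\sqrt3,0)\},\\ \mathcal C_3&=\{(a,b,c): a=b+c,\ f(b,c)=0,\ c\in(0,1/\sqrt3)\},\\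 P_1&=(2/\sqrt3,1/\sqrt3,1/\sqrt3),\quad P_2=(2/\sqrt3,1/\sqrt3,-1/\sqrt3),\quad P_3=(1,1,0), \end{align*} and \begin{align*} f(b,c)={}&\big((b+c)^3-(c^2+1)^{3/2}\big)\big((b^2+1)^{3/2}-(b-c)^3\big)\\&-\big((b^2+1)^{3/2}-(b+c)^3\big)\big((c^2+1)^{3/2}-(b-c)^3\big). \end{align*} (iii) At each point of $\mathcal C_1$, $q_1,q_2,q_3$ form an equilateral triangle and $q$ is a CC of the restricted problem for some masses $m_1=1$, $m_2,m_3>0$, $m_4=0$. The points of $\mathcal C_2$ are rhombi and those of $\mathcal C_3$ are isosceles trapezoids (not parallelograms) with longer base $q_1q_2$, and all of them are CCs for some positive masses with $m_1=1$. At $P_1$, $q_1,q_2,q_3$ form an equilateral triangle, $q_3=q_4$, and $q$ is a CC of the restricted problem for some masses $m_1=1$, $m_2>0$, $m_3=m_4=0$. At $P_2$, $q$ is a rhombus in which $q_1,q_2,q_3$ form an equilateral triangle, and it is a CC of the restricted problem for some masses $m_1=1$, $m_3>0$, $m_2=m_4=0$. At $P_3$, $q$ is a square and is a CC for some positive masses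 with $m_1=1$. -/

import Mathlib

noncomputable section

namespace TrapezoidCC

/-- The Euclidean plane. -/
abbrev Plane := EuclideanSpace ℝ (Fin 2)

/-- Newtonian acceleration (with gravitational constant `1`) of the `i`-th body, for masses `m`
at the positions `q`. A body of mass zero contributes the zero vector. -/
def accel {n : ℕ} (m : Fin n → ℝ) (q : Fin n → Plane) (i : Fin n) : Plane :=
  ∑ j ∈ Finset.univ.erase i, (m j / dist (q i) (q j) ^ 3) • (q j - q i)

/-- The equations of a central configuration: there is `l > 0` such that the acceleration of
every body is `-l` times its position relative to the centre of mass. -/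
def CentralEquations {n : ℕ} (m : Fin n → ℝ) (q : Fin n → Plane) : Prop :=
  ∃ l : ℝ, 0 < l ∧ ∀ i, accel m q i = -(l • (q i - Finset.univ.centerMass m q))

/-- Central configuration of positive masses at pairwise distinct positions. -/
def IsCentral {n : ℕ} (m : Fin n → ℝ) (q : Fin n → Plane) : Prop :=
  (∀ i, 0 < m i) ∧ Function.Injective q ∧ CentralEquations m q

/-- Central configuration of the restricted problem: the masses are nonnegative and not all
zero, at least one of them is zero, and only bodies of mass zero may share a position. -/
def IsRestrictedCentral {n : ℕ} (m : Fin n → ℝ) (q : Fin n → Plane) : Prop :=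
  (∀ i, 0 ≤ m i) ∧ (∃ i, 0 < m i) ∧ (∃ i, m i = 0) ∧
    (∀ i j, i ≠ j → q i = q j → m i = 0 ∧ m j = 0) ∧ CentralEquations m q

/-! The bodies `1, 2, 3, 4` have the indices `0, 1, 2, 3`. The sides of the quadrilateral are
`01`, `12`, `23`, `30`, its diagonals are `02` and `13`. -/

/-- The four points are the vertices of a trapezoid, i.e. of a convex quadrilateral with at least
one pair of parallel sides: in a suitable order they are the consecutive vertices `A, B, C, D`,
not collinear, with `B - A = t (C - D)` for some `t > 0`. -/
def IsTrapezoid (q : Fin 4 → Plane) : Prop :=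
  ∃ (σ : Equiv.Perm (Fin 4)) (t : ℝ), 0 < t ∧ q (σ 1) - q (σ 0) = t • (q (σ 2) - q (σ 3)) ∧
    ¬ Collinear ℝ {q (σ 0), q (σ 1), q (σ 3)}

/-- Isosceles trapezoid with consecutive vertices `q 0, q 1, q 2, q 3`, longer base from `q 0` to
`q 1`, and shorter base from `q 3` to `q 2`. -/
def IsIsoscelesTrapezoid (q : Fin 4 → Plane) : Prop :=
  ¬ Collinear ℝ {q 0, q 1, q 3} ∧
    (∃ t : ℝ, 1 < t ∧ q 1 - q 0 = t • (q 2 - q 3)) ∧ dist (q 1) (q 2) = dist (q 0) (q 3)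

/-- Rhombus with consecutive vertices `q 0, q 1, q 2, q 3`. -/
def IsRhombus (q : Fin 4 → Plane) : Prop :=
  Function.Injective q ∧ dist (q 0) (q 1) = dist (q 1) (q 2) ∧
    dist (q 1) (q 2) = dist (q 2) (q 3) ∧ dist (q 2) (q 3) = dist (q 3) (q 0)

/-- Square with consecutive vertices `q 0, q 1, q 2, q 3`. -/
def IsSquareConfig (q : Fin 4 → Plane) : Prop :=
  IsRhombus q ∧ dist (q 0) (q 2) = dist (q 1) (q 3)

/-- The bodies `1, 2, 3` are the vertices of a nondegenerate equilateral triangle. -/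
def FirstThreeEquilateral (q : Fin 4 → Plane) : Prop :=
  q 0 ≠ q 1 ∧ dist (q 0) (q 1) = dist (q 1) (q 2) ∧ dist (q 1) (q 2) = dist (q 0) (q 2)

/-- The left-hand side `D` of the Dziobek equation. -/
def dziobek (q : Fin 4 → Plane) : ℝ :=
  (dist (q 0) (q 2) ^ 3 - dist (q 0) (q 1) ^ 3) * (dist (q 1) (q 2) ^ 3 - dist (q 2) (q 3) ^ 3) *
      (dist (q 1) (q 3) ^ 3 - dist (q 0) (q 3) ^ 3) -
    (dist (q 0) (q 1) ^ 3 - dist (q 0) (q 3) ^ 3) * (dist (q 1) (q 3) ^ 3 - dist (q 2) (q 3) ^ 3) *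
      (dist (q 0) (q 2) ^ 3 - dist (q 1) (q 2) ^ 3)

/-- The positions `(0,0), (0,a), (1,b), (1,c)` for the parameter `(a, b, c)`. -/
def position (p : ℝ × ℝ × ℝ) : Fin 4 → Plane :=
  ![!₂[0, 0], !₂[0, p.1], !₂[1, p.2.1], !₂[1, p.2.2]]

/-- The set `Ω`: `D = 0` and `r₂₄ ≥ r₁₃ > r₁₂ ≥ r₂₃ ≥ r₁₄ ≥ r₃₄`. -/
def Omega : Set (ℝ × ℝ × ℝ) :=
  {p | 1 ≤ p.1 ∧ p.2.2 < p.2.1 ∧ dziobek (position p) = 0 ∧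
    dist (position p 0) (position p 2) ≤ dist (position p 1) (position p 3) ∧
    dist (position p 0) (position p 1) < dist (position p 0) (position p 2) ∧
    dist (position p 1) (position p 2) ≤ dist (position p 0) (position p 1) ∧
    dist (position p 0) (position p 3) ≤ dist (position p 1) (position p 2) ∧
    dist (position p 2) (position p 3) ≤ dist (position p 0) (position p 3)}

/-- The labelling convention for trapezoids: `r₁₂` is the longest side, `r₂₃ ≥ r₁₄`, and
`r₂₄ ≥ r₁₃`. -/
def ConvenientlyLabelled (q : Fin 4 → Plane) : Prop :=
  dist (q 1) (q 2) ≤ dist (q 0) (q 1) ∧ dist (q 2) (q 3) ≤ dist (q 0) (q 1) ∧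
    dist (q 0) (q 3) ≤ dist (q 0) (q 1) ∧ dist (q 0) (q 3) ≤ dist (q 1) (q 2) ∧
    dist (q 0) (q 2) ≤ dist (q 1) (q 3)

/-- The parameters, with `a ≥ 1` and `b > c`, of the realizable central configurations, i.e. those
that are central for some positive masses with `m₁ = 1`, with the labelling convention. -/
def Realizable : Set (ℝ × ℝ × ℝ) :=
  {p | 1 ≤ p.1 ∧ p.2.2 < p.2.1 ∧ ConvenientlyLabelled (position p) ∧
    ∃ m : Fin 4 → ℝ, m 0 = 1 ∧ IsCentral m (position p)}

/-- The surface `D = 0` in the space of the parameters. -/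
def dziobekSurface : Set (ℝ × ℝ × ℝ) := {p | dziobek (position p) = 0}

/-- The boundary of `A` relative to `S`: the topological boundary of `S ∩ A` in the subspace `S`
of `X`, regarded as a subset of `X`. -/
def relBoundary {X : Type*} [TopologicalSpace X] (S A : Set X) : Set X :=
  ((↑) : S → X) '' frontier (((↑) : S → X) ⁻¹' A)

def C1 : Set (ℝ × ℝ × ℝ) :=
  {p | ∃ c : ℝ, -1 / √3 < c ∧ c < 1 / √3 ∧ p = (2 / √3, 1 / √3, c)}

def C2 : Set (ℝ × ℝ × ℝ) :=
  {p | ∃ c : ℝ, -1 / √3 < c ∧ c < 0 ∧ p = (√(1 + c ^ 2), c + √(1 + c ^ 2), c)}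

def f (b c : ℝ) : ℝ :=
  ((b + c) ^ 3 - (c ^ 2 + 1) ^ (3 / 2 : ℝ)) * ((b ^ 2 + 1) ^ (3 / 2 : ℝ) - (b - c) ^ 3) -
    ((b ^ 2 + 1) ^ (3 / 2 : ℝ) - (b + c) ^ 3) * ((c ^ 2 + 1) ^ (3 / 2 : ℝ) - (b - c) ^ 3)

def C3 : Set (ℝ × ℝ × ℝ) :=
  {p | ∃ a b c : ℝ, a = b + c ∧ f b c = 0 ∧ 0 < c ∧ c < 1 / √3 ∧ p = (a, b, c)}

def P1 : ℝ × ℝ × ℝ := (2 / √3, 1 / √3, 1 / √3)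

def P2 : ℝ × ℝ × ℝ := (2 / √3, 1 / √3, -1 / √3)

def P3 : ℝ × ℝ × ℝ := (1, 1, 0)

end TrapezoidCC

end

/-!
Bodies and vertices are numbered from `1` in comments and from `0` in the code. Write `τ` for the
ratio of the base `q₄ q₃` to the base `q₁ q₂`, `k` for the multiplier divided by the total mass, and
`Sᵢⱼ = 1 / rᵢⱼ³ - k`.

*Central configurations.* The equations say `∑ⱼ mⱼ Sᵢⱼ (qⱼ - qᵢ) = 0`. In the basis formed by a base
and a leg they become eight scalar equations (`ScalarEquations`). For positive masses these force
the four sides to have `Sᵢⱼ` of one sign and the diagonals of the other, and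
`S₁₂ S₃₄ = S₁₃ S₂₄ = S₁₄ S₂₃`. By the parallelogram law the diagonals are the longer ones, the
elimination of `k` gives `D = 0`, and `r₂₃ ≤ r₁₂` gives `r₃₄ ≤ r₁₄` (`IsCentral.trapezoid`).
Conversely, on `Ω` the equation `D = 0` supplies a `k` between `1 / r₁₃³` and `1 / r₁₂³`
(`exists_multiplier`), and the eight equations are solved for positive masses. An arbitrary trapezoid
is relabelled so that `q₁ q₂` is the longer base and `q₂ q₄` the longer diagonal; then no leg exceeds
`q₁ q₂` (`IsCentral.exists_similar_of_labelled`).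

*The boundary lies in the curves.* A boundary point satisfies the inequalities of `Ω` in the weak
sense, one of them being an equality. When two of the distances agree, `D` factorizes, and each case
leads to an equilateral triangle, a rhombus or an isosceles trapezoid (`relBoundary_subset`).

*The curves lie in the boundary.* Near each point there is a short segment on which `D` changes its
sign, so it has a zero there (`mem_closure_zeros`). For the equilateral triangles the segment is
chosen inside `r₁₃ ≥ r₁₂ ≥ r₂₃`, and its zeros are in `Ω`; for the rhombi and the isosceles
trapezoids, which are in `Ω`, it is chosen outside `Ω`. For isosceles trapezoids `D` is a multiple of
`f`, whose sign is that of a cross-ratio minus `1`; this cross-ratio is strictly monotone in `b`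
(`IsosRegion.crossRatio_lt`), so `f` changes its sign at each of its zeros. All these zeros are in
the region where the distances have the required order (`isosRegion_of_f_eq_zero`).
-/

namespace TrapezoidCC

open Filter Topology Set

/-! ### The Dziobek polynomial -/

/-- The cube of a distance, as a function of the square of the distance. -/
noncomputable def cubeOfSq (x : ℝ) : ℝ := √x ^ 3

lemma cubeOfSq_lt {x y : ℝ} (hx : 0 ≤ x) (h : x < y) : cubeOfSq x < cubeOfSq y :=
  pow_lt_pow_left₀ (Real.sqrt_lt_sqrt hx h) (Real.sqrt_nonneg x) (by norm_num)

lemma cubeOfSq_le {x y : ℝ} (h : x ≤ y) : cubeOfSq x ≤ cubeOfSq y :=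
  pow_le_pow_left₀ (Real.sqrt_nonneg x) (Real.sqrt_le_sqrt h) 3

lemma continuous_cubeOfSq : Continuous cubeOfSq := by
  unfold cubeOfSq; fun_prop

/-- The Dziobek expression as a polynomial in the cubes of the mutual distances. -/
def dziobekPoly (u₁₂ u₁₃ u₁₄ u₂₃ u₂₄ u₃₄ : ℝ) : ℝ :=
  (u₁₃ - u₁₂) * (u₂₃ - u₃₄) * (u₂₄ - u₁₄) - (u₁₂ - u₁₄) * (u₂₄ - u₃₄) * (u₁₃ - u₂₃)

/-! ### Distances in the normalized coordinates -/

lemma dist_position_01 (a b c : ℝ) :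
    dist (position (a, b, c) 0) (position (a, b, c) 1) = √(a ^ 2) := by
  simp [position, EuclideanSpace.dist_eq, Real.dist_eq]

lemma dist_position_02 (a b c : ℝ) :
    dist (position (a, b, c) 0) (position (a, b, c) 2) = √(1 + b ^ 2) := by
  simp [position, EuclideanSpace.dist_eq, Real.dist_eq]

lemma dist_position_03 (a b c : ℝ) :
    dist (position (a, b, c) 0) (position (a, b, c) 3) = √(1 + c ^ 2) := by
  simp [position, EuclideanSpace.dist_eq, Real.dist_eq]

lemma dist_position_12 (a b c : ℝ) :
    dist (position (a, b, c) 1) (position (a, b, c) 2) = √(1 + (a - b) ^ 2) := by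
  simp [position, EuclideanSpace.dist_eq, Real.dist_eq]

lemma dist_position_13 (a b c : ℝ) :
    dist (position (a, b, c) 1) (position (a, b, c) 3) = √(1 + (a - c) ^ 2) := by
  simp [position, EuclideanSpace.dist_eq, Real.dist_eq]

lemma dist_position_23 (a b c : ℝ) :
    dist (position (a, b, c) 2) (position (a, b, c) 3) = √((b - c) ^ 2) := by
  simp [position, EuclideanSpace.dist_eq, Real.dist_eq]

lemma dziobek_position (a b c : ℝ) : dziobek (position (a, b, c)) =
    dziobekPoly (cubeOfSq (a ^ 2)) (cubeOfSq (1 + b ^ 2)) (cubeOfSq (1 + c ^ 2))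
      (cubeOfSq (1 + (a - b) ^ 2)) (cubeOfSq (1 + (a - c) ^ 2)) (cubeOfSq ((b - c) ^ 2)) := by
  simp only [dziobek, dist_position_01, dist_position_02, dist_position_03, dist_position_12,
    dist_position_13, dist_position_23, dziobekPoly, cubeOfSq]

lemma continuous_dziobek_position : Continuous fun p => dziobek (position p) := by
  have h : (fun p : ℝ × ℝ × ℝ => dziobek (position p)) = fun p => _ :=
    funext fun p => dziobek_position p.1 p.2.1 p.2.2
  rw [h]
  unfold dziobekPoly
  have := continuous_cubeOfSq
  fun_prop

lemma mem_Omega_iff (a b c : ℝ) : (a, b, c) ∈ Omega ↔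
    1 ≤ a ∧ c < b ∧ dziobek (position (a, b, c)) = 0 ∧ b ^ 2 ≤ (a - c) ^ 2 ∧ a ^ 2 < 1 + b ^ 2 ∧
      1 + (a - b) ^ 2 ≤ a ^ 2 ∧ c ^ 2 ≤ (a - b) ^ 2 ∧ (b - c) ^ 2 ≤ 1 + c ^ 2 := by
  simp only [Omega, mem_ofPred_eq, dist_position_01, dist_position_02, dist_position_03,
    dist_position_12, dist_position_13, dist_position_23]
  rw [Real.sqrt_le_sqrt_iff (by positivity), Real.sqrt_lt_sqrt_iff (by positivity),
    Real.sqrt_le_sqrt_iff (by positivity), Real.sqrt_le_sqrt_iff (by positivity),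
    Real.sqrt_le_sqrt_iff (by positivity)]
  simp only [add_le_add_iff_left]

/-! ### Central configurations of a trapezoid as scalar equations -/

/-- The difference of `1 / r ^ 3` and the multiplier `k`. -/
noncomputable def strength (k : ℝ) (q : Fin 4 → Plane) (i j : Fin 4) : ℝ :=
  (dist (q i) (q j) ^ 3)⁻¹ - k

lemma strength_comm (k : ℝ) (q : Fin 4 → Plane) (i j : Fin 4) :
    strength k q i j = strength k q j i := by
  simp [strength, dist_comm]

/-- The position relative to the centre of mass is a sum over the mutual differences of positions, so
that both sides of the equations combine into one sum. -/
lemma accel_add_smul_sub_centerMass {m : Fin 4 → ℝ} (q : Fin 4 → Plane) (hm : 0 < ∑ i, m i)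
    (k : ℝ) (i : Fin 4) :
    accel m q i + (k * ∑ i, m i) • (q i - Finset.univ.centerMass m q) =
      ∑ j, (m j * strength k q i j) • (q j - q i) := by
  have h1 : accel m q i = ∑ j, (m j / dist (q i) (q j) ^ 3) • (q j - q i) := by
    rw [accel, ← Finset.add_sum_erase _ _ (Finset.mem_univ i)]; simp
  have h2 : (∑ i, m i) • (q i - Finset.univ.centerMass m q) = ∑ j, m j • (q i - q j) := by
    rw [Finset.centerMass, smul_sub, smul_smul, mul_inv_cancel₀ hm.ne', one_smul, Finset.sum_smul,
      ← Finset.sum_sub_distrib]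
    simp [smul_sub]
  rw [h1, mul_smul, h2, Finset.smul_sum, ← Finset.sum_add_distrib]
  refine Finset.sum_congr rfl fun j _ => ?_
  rw [strength, ← neg_sub (q j) (q i)]
  module

/-- The equations of a central configuration, written for the differences of positions. -/
lemma centralEquations_iff {m : Fin 4 → ℝ} (q : Fin 4 → Plane) (hm : 0 < ∑ i, m i) :
    CentralEquations m q ↔
      ∃ k : ℝ, 0 < k ∧ ∀ i, ∑ j, (m j * strength k q i j) • (q j - q i) = 0 := by
  constructor
  · rintro ⟨l, hl, h⟩
    refine ⟨l / ∑ i, m i, div_pos hl hm, fun i => ?_⟩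
    rw [← accel_add_smul_sub_centerMass q hm, h i, div_mul_cancel₀ _ hm.ne']
    simp
  · rintro ⟨k, hk, h⟩
    refine ⟨k * ∑ i, m i, mul_pos hk hm, fun i => ?_⟩
    rw [eq_neg_iff_add_eq_zero, accel_add_smul_sub_centerMass q hm, h i]

/-- The equations of a central configuration for a quadrilateral with parallel sides `q 0 q 1` and
`q 3 q 2`, of ratio `τ`, in the basis formed by the directions of a base and a leg. -/
structure ScalarEquations (m : Fin 4 → ℝ) (S : Fin 4 → Fin 4 → ℝ) (τ : ℝ) : Prop where
  leg₀ : m 2 * S 0 2 + m 3 * S 0 3 = 0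
  base₀ : m 1 * S 0 1 + τ * (m 2 * S 0 2) = 0
  leg₁ : m 2 * S 1 2 + m 3 * S 1 3 = 0
  base₁ : m 0 * S 0 1 = τ * (m 2 * S 1 2)
  leg₂ : m 0 * S 0 2 + m 1 * S 1 2 = 0
  base₂ : m 1 * S 1 2 = τ * (m 3 * S 2 3)
  leg₃ : m 0 * S 0 3 + m 1 * S 1 3 = 0
  base₃ : m 1 * S 1 3 + τ * (m 2 * S 2 3) = 0

lemma centralEquations_of_scalarEquations {m : Fin 4 → ℝ} {q : Fin 4 → Plane} {τ k : ℝ}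
    (hq : q 2 - q 3 = τ • (q 1 - q 0)) (hm : 0 < ∑ i, m i) (hk : 0 < k)
    (h : ScalarEquations m (strength k q) τ) : CentralEquations m q := by
  obtain ⟨h1, h2, h3, h4, h5, h6, h7, h8⟩ := h
  refine (centralEquations_iff q hm).2 ⟨k, hk, fun i => ?_⟩
  have e2 : q 2 = q 3 + τ • (q 1 - q 0) := by rw [← hq]; abel
  have c1 := strength_comm k q 1 0
  have c2 := strength_comm k q 2 0
  have c3 := strength_comm k q 3 0
  have c4 := strength_comm k q 2 1
  have c5 := strength_comm k q 3 1
  have c6 := strength_comm k q 3 2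
  fin_cases i <;>
    simp only [Fin.sum_univ_four, Fin.zero_eta, Fin.mk_one, Fin.reduceFinMk, sub_self, smul_zero,
      c1, c2, c3, c4, c5, c6, e2]
  · linear_combination (norm := module) h1 • (q 3 - q 0) + h2 • (q 1 - q 0)
  · linear_combination (norm := module) h3 • (q 3 - q 1) - h4 • (q 1 - q 0)
  · linear_combination (norm := module) h5 • (q 0 - q 3 - τ • (q 1 - q 0)) + h6 • (q 1 - q 0)
  · linear_combination (norm := module) h7 • (q 0 - q 3) + h8 • (q 1 - q 0)

lemma CentralEquations.exists_scalarEquations {m : Fin 4 → ℝ} {q : Fin 4 → Plane} {τ : ℝ}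
    (h : CentralEquations m q) (hm : 0 < ∑ i, m i) (hq : q 2 - q 3 = τ • (q 1 - q 0))
    (hli : LinearIndependent ℝ ![q 1 - q 0, q 3 - q 0]) :
    ∃ k : ℝ, 0 < k ∧ ScalarEquations m (strength k q) τ := by
  obtain ⟨k, hk, h⟩ := (centralEquations_iff q hm).1 h
  refine ⟨k, hk, ?_⟩
  have e2 : q 2 = q 3 + τ • (q 1 - q 0) := by rw [← hq]; abel
  have c1 := strength_comm k q 1 0
  have c2 := strength_comm k q 2 0
  have c3 := strength_comm k q 3 0
  have c4 := strength_comm k q 2 1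
  have c5 := strength_comm k q 3 1
  have c6 := strength_comm k q 3 2
  rw [LinearIndependent.pair_iff] at hli
  have h0 := h 0
  have h1 := h 1
  have h2 := h 2
  have h3 := h 3
  simp only [Fin.sum_univ_four, sub_self, smul_zero, c1, c2, c3, c4, c5, c6, e2] at h0 h1 h2 h3
  obtain ⟨a0, b0⟩ := hli (m 1 * strength k q 0 1 + τ * (m 2 * strength k q 0 2))
    (m 2 * strength k q 0 2 + m 3 * strength k q 0 3) (by rw [← h0]; module)
  obtain ⟨a1, b1⟩ := hli (-(m 0 * strength k q 0 1) + τ * (m 2 * strength k q 1 2)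
      - (m 2 * strength k q 1 2 + m 3 * strength k q 1 3))
    (m 2 * strength k q 1 2 + m 3 * strength k q 1 3) (by rw [← h1]; module)
  obtain ⟨a2, b2⟩ := hli (m 1 * strength k q 1 2 - τ * (m 3 * strength k q 2 3)
      - τ * (m 0 * strength k q 0 2 + m 1 * strength k q 1 2))
    (-(m 0 * strength k q 0 2 + m 1 * strength k q 1 2)) (by rw [← h2]; module)
  obtain ⟨a3, b3⟩ := hli (m 1 * strength k q 1 3 + τ * (m 2 * strength k q 2 3))
    (-(m 0 * strength k q 0 3 + m 1 * strength k q 1 3)) (by rw [← h3]; module)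
  rw [neg_eq_zero] at b2 b3
  exact ⟨b0, a0, b1, by linear_combination -a1 - b1, b2, by linear_combination a2 + τ * b2, b3, a3⟩

/-! ### Consequences of the equations for the distances -/

lemma dziobekPoly_inv {x₁₂ x₁₃ x₁₄ x₂₃ x₂₄ x₃₄ : ℝ} (h₁₂ : x₁₂ ≠ 0) (h₁₃ : x₁₃ ≠ 0)
    (h₁₄ : x₁₄ ≠ 0) (h₂₃ : x₂₃ ≠ 0) (h₂₄ : x₂₄ ≠ 0) (h₃₄ : x₃₄ ≠ 0) :
    dziobekPoly x₁₂ x₁₃ x₁₄ x₂₃ x₂₄ x₃₄ = x₁₂ * x₁₃ * x₁₄ * x₂₃ * x₂₄ * x₃₄ *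
      ((x₁₂⁻¹ - x₁₃⁻¹) * (x₃₄⁻¹ - x₂₃⁻¹) * (x₁₄⁻¹ - x₂₄⁻¹) -
        (x₁₄⁻¹ - x₁₂⁻¹) * (x₃₄⁻¹ - x₂₄⁻¹) * (x₂₃⁻¹ - x₁₃⁻¹)) := by
  unfold dziobekPoly
  field_simp

namespace ScalarEquations

variable {m : Fin 4 → ℝ} {S : Fin 4 → Fin 4 → ℝ} {τ : ℝ}

lemma mul_eq_mul (h : ScalarEquations m S τ) (hm : ∀ i, 0 < m i) (hτ : 0 < τ) :
    S 0 1 * S 2 3 = S 0 2 * S 1 3 ∧ S 0 3 * S 1 2 = S 0 2 * S 1 3 := by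
  have m1 := hm 1
  have m2 := hm 2
  have m3 := hm 3
  refine ⟨mul_left_cancel₀ (show m 1 * (τ * m 2) ≠ 0 by positivity) ?_,
    mul_left_cancel₀ (show m 2 * m 3 ≠ 0 by positivity) ?_⟩
  · linear_combination (τ * m 2 * S 2 3) * h.base₀ - (τ * m 2 * S 0 2) * h.base₃
  · linear_combination (m 2 * S 1 2) * h.leg₀ - (m 2 * S 0 2) * h.leg₁

/-- The two diagonals carry strengths of one sign, and the four sides those of the other sign. -/
lemma signs (h : ScalarEquations m S τ) (hm : ∀ i, 0 < m i) (hτ : 0 < τ) :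
    (S 0 2 < 0 ∧ S 1 3 < 0 ∧ 0 < S 0 1 ∧ 0 < S 1 2 ∧ 0 < S 2 3 ∧ 0 < S 0 3) ∨
      (0 ≤ S 0 2 ∧ 0 ≤ S 1 3 ∧ S 1 2 ≤ 0 ∧ S 0 3 ≤ 0) := by
  have m0 := hm 0
  have m1 := hm 1
  have m2 := hm 2
  have m3 := hm 3
  rcases lt_or_ge (S 0 2) 0 with h02 | h02
  · left
    have h12 : 0 < S 1 2 := by
      have : 0 < m 1 * S 1 2 := by nlinarith [h.leg₂]
      exact pos_of_mul_pos_right this m1.le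
    refine ⟨h02, ?_, ?_, h12, ?_, ?_⟩
    · have : 0 < m 3 * -S 1 3 := by nlinarith [h.leg₁]
      linarith [pos_of_mul_pos_right this m3.le]
    · have : 0 < m 0 * S 0 1 := by rw [h.base₁]; positivity
      exact pos_of_mul_pos_right this m0.le
    · have : 0 < τ * m 3 * S 2 3 := by
        rw [mul_assoc, ← h.base₂]; positivity
      exact pos_of_mul_pos_right this (by positivity)
    · have : 0 < m 3 * S 0 3 := by nlinarith [h.leg₀]
      exact pos_of_mul_pos_right this m3.le
  · right
    have h12 : 0 ≤ -S 1 2 := by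
      have : 0 ≤ m 1 * -S 1 2 := by nlinarith [h.leg₂, mul_nonneg m0.le h02]
      exact nonneg_of_mul_nonneg_right this m1
    refine ⟨h02, ?_, by linarith, ?_⟩
    · have : 0 ≤ m 3 * S 1 3 := by nlinarith [h.leg₁, mul_nonneg m2.le h12]
      exact nonneg_of_mul_nonneg_right this m3
    · have : 0 ≤ m 3 * -S 0 3 := by nlinarith [h.leg₀, mul_nonneg m2.le h02]
      linarith [nonneg_of_mul_nonneg_right this m3]

end ScalarEquations

/-- The oriented area spanned by two vectors of the plane. -/
def cross (u v : Plane) : ℝ := u 0 * v 1 - u 1 * v 0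

lemma linearIndependent_of_cross_ne_zero {u v : Plane} (h : cross u v ≠ 0) :
    LinearIndependent ℝ ![u, v] := by
  rw [LinearIndependent.pair_iff]
  intro s t hst
  have h0 : s * u 0 + t * v 0 = 0 := by simpa using congrArg (fun x : Plane => x 0) hst
  have h1 : s * u 1 + t * v 1 = 0 := by simpa using congrArg (fun x : Plane => x 1) hst
  unfold cross at h
  constructor
  · refine (mul_eq_zero.1 (?_ : s * (u 0 * v 1 - u 1 * v 0) = 0)).resolve_right h
    linear_combination v 1 * h0 - v 0 * h1
  · refine (mul_eq_zero.1 (?_ : t * (u 0 * v 1 - u 1 * v 0) = 0)).resolve_right h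
    linear_combination u 0 * h1 - u 1 * h0

lemma cross_ne_zero_of_not_collinear {x y z : Plane} (h : ¬ Collinear ℝ {x, y, z}) :
    cross (y - x) (z - x) ≠ 0 := by
  contrapose! h
  rcases eq_or_ne y x with rfl | hxy
  · simpa using collinear_pair ℝ y z
  rw [collinear_iff_of_mem (p₀ := x) (by simp)]
  refine ⟨y - x, ?_⟩
  simp only [mem_insert_iff, mem_singleton_iff, forall_eq_or_imp, forall_eq]
  refine ⟨⟨0, by simp⟩, ⟨1, by simp⟩, ?_⟩
  simp only [cross, PiLp.sub_apply] at h
  by_cases h0 : y 0 - x 0 = 0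
  · have h1 : y 1 - x 1 ≠ 0 := by
      intro h1
      apply hxy
      ext i
      fin_cases i
      · exact sub_eq_zero.1 h0
      · exact sub_eq_zero.1 h1
    refine ⟨(z 1 - x 1) / (y 1 - x 1), ?_⟩
    ext i
    fin_cases i
    · simp
      field_simp
      linear_combination -h
    · simp
      field_simp
      ring
  · refine ⟨(z 0 - x 0) / (y 0 - x 0), ?_⟩
    ext i
    fin_cases i
    · simp
      field_simp
      ring
    · simp
      field_simp
      linear_combination h

lemma dist_sq_eq (x y : Plane) : dist x y ^ 2 = (x 0 - y 0) ^ 2 + (x 1 - y 1) ^ 2 := by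
  rw [EuclideanSpace.dist_eq, Real.sq_sqrt (by positivity)]
  simp [Real.dist_eq]

lemma strength_lt_strength {k : ℝ} {q : Fin 4 → Plane} {i j i' j' : Fin 4}
    (h : strength k q i j < strength k q i' j') (hne : q i ≠ q j) :
    dist (q i') (q j') < dist (q i) (q j) := by
  by_contra! hle
  have : (dist (q i') (q j') ^ 3)⁻¹ ≤ (dist (q i) (q j) ^ 3)⁻¹ := by
    have := dist_pos.2 hne
    gcongr
  unfold strength at h
  linarith

lemma strength_le_strength {k : ℝ} {q : Fin 4 → Plane} {i j i' j' : Fin 4}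
    (h : dist (q i') (q j') ≤ dist (q i) (q j)) (hne : q i' ≠ q j') :
    strength k q i j ≤ strength k q i' j' := by
  have : (dist (q i) (q j) ^ 3)⁻¹ ≤ (dist (q i') (q j') ^ 3)⁻¹ := by
    have := dist_pos.2 hne
    gcongr
  unfold strength
  linarith

/-- A central configuration at the vertices of a trapezoid satisfies the Dziobek equation, its
diagonals are longer than its sides, and the order of the sides `q 0 q 1`, `q 1 q 2` is opposite
to that of the sides `q 2 q 3`, `q 0 q 3`. -/
lemma IsCentral.trapezoid {m : Fin 4 → ℝ} {q : Fin 4 → Plane} {τ : ℝ} (h : IsCentral m q)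
    (hq : q 2 - q 3 = τ • (q 1 - q 0)) (hτ : 0 < τ) (hx : cross (q 1 - q 0) (q 3 - q 0) ≠ 0) :
    dziobek q = 0 ∧ dist (q 0) (q 1) < dist (q 0) (q 2) ∧ dist (q 1) (q 2) < dist (q 0) (q 2) ∧
      (dist (q 1) (q 2) ≤ dist (q 0) (q 1) → dist (q 2) (q 3) ≤ dist (q 0) (q 3)) ∧
      (dist (q 0) (q 1) < dist (q 1) (q 2) → dist (q 0) (q 3) < dist (q 2) (q 3)) := by
  obtain ⟨hm, hinj, hc⟩ := h
  have hM : 0 < ∑ i, m i := Finset.sum_pos (fun i _ => hm i) (by simp)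
  obtain ⟨k, hk, hs⟩ := hc.exists_scalarEquations hM hq (linearIndependent_of_cross_ne_zero hx)
  have hne : ∀ i j, i ≠ j → q i ≠ q j := fun i j hij => hinj.ne hij
  have n01 := hne 0 1 (by decide)
  have n02 := hne 0 2 (by decide)
  have n03 := hne 0 3 (by decide)
  have n12 := hne 1 2 (by decide)
  have n13 := hne 1 3 (by decide)
  have n23 := hne 2 3 (by decide)
  obtain ⟨e1, e2⟩ := hs.mul_eq_mul hm hτ
  have hD : dziobek q = 0 := by
    have := dist_pos.2 n01
    have := dist_pos.2 n02
    have := dist_pos.2 n03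
    have := dist_pos.2 n12
    have := dist_pos.2 n13
    have := dist_pos.2 n23
    have hdz : dziobek q = dziobekPoly (dist (q 0) (q 1) ^ 3) (dist (q 0) (q 2) ^ 3)
      (dist (q 0) (q 3) ^ 3) (dist (q 1) (q 2) ^ 3) (dist (q 1) (q 3) ^ 3)
      (dist (q 2) (q 3) ^ 3) := rfl
    rw [hdz, dziobekPoly_inv (by positivity) (by positivity) (by positivity) (by positivity)
      (by positivity) (by positivity)]
    refine mul_eq_zero_of_right _ ?_
    unfold strength at e1 e2
    -- the bracket is a determinant in the strengths, so it does not depend on `k`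
    linear_combination ((dist (q 0) (q 3) ^ 3)⁻¹ + (dist (q 1) (q 2) ^ 3)⁻¹
      - (dist (q 0) (q 2) ^ 3)⁻¹ - (dist (q 1) (q 3) ^ 3)⁻¹) * e1
      + ((dist (q 0) (q 2) ^ 3)⁻¹ + (dist (q 1) (q 3) ^ 3)⁻¹
      - (dist (q 0) (q 1) ^ 3)⁻¹ - (dist (q 2) (q 3) ^ 3)⁻¹) * e2
  refine ⟨hD, ?_⟩
  rcases hs.signs hm hτ with ⟨h02, h13, h01, h12, h23, h03⟩ | ⟨h02, h13, h12, h03⟩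
  · refine ⟨strength_lt_strength (k := k) (by linarith) n02,
      strength_lt_strength (k := k) (by linarith) n02, fun hle => ?_, fun hlt => ?_⟩
    · by_contra! hlt
      have h1 := strength_le_strength (k := k) hle n12
      have h2 : strength k q 2 3 < strength k q 0 3 := by
        by_contra! h3
        have h4 := inv_strictAnti₀ (pow_pos (dist_pos.2 n03) 3)
          (pow_lt_pow_left₀ hlt dist_nonneg (three_ne_zero))
        unfold strength at h3
        linarith
      nlinarith
    · have h1 : strength k q 1 2 < strength k q 0 1 := by
        have h4 := inv_strictAnti₀ (pow_pos (dist_pos.2 n01) 3)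
          (pow_lt_pow_left₀ hlt dist_nonneg (three_ne_zero))
        unfold strength
        linarith
      refine strength_lt_strength (k := k) ?_ n23
      by_contra! h3
      nlinarith
  · -- both diagonals would be at most as long as the legs, against the parallelogram law
    exfalso
    have l1 : dist (q 0) (q 2) ≤ dist (q 0) (q 3) := by
      by_contra! hlt
      have h4 := inv_strictAnti₀ (pow_pos (dist_pos.2 n03) 3)
          (pow_lt_pow_left₀ hlt dist_nonneg (three_ne_zero))
      unfold strength at h02 h03
      linarith
    have l2 : dist (q 1) (q 3) ≤ dist (q 1) (q 2) := by
      by_contra! hlt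
      have h4 := inv_strictAnti₀ (pow_pos (dist_pos.2 n12) 3)
          (pow_lt_pow_left₀ hlt dist_nonneg (three_ne_zero))
      unfold strength at h12 h13
      linarith
    have l3 := pow_le_pow_left₀ dist_nonneg l1 2
    have l4 := pow_le_pow_left₀ dist_nonneg l2 2
    have l5 := pow_pos (dist_pos.2 n01) 2
    rw [dist_sq_eq, dist_sq_eq] at l3 l4
    rw [dist_sq_eq] at l5
    have c0 : q 2 0 - q 3 0 = τ * (q 1 0 - q 0 0) := by
      simpa using congrArg (fun x : Plane => x 0) hq
    have c1 : q 2 1 - q 3 1 = τ * (q 1 1 - q 0 1) := by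
      simpa using congrArg (fun x : Plane => x 1) hq
    have := mul_pos hτ l5
    have z0 : q 2 0 = q 3 0 + τ * (q 1 0 - q 0 0) := by linarith
    have z1 : q 2 1 = q 3 1 + τ * (q 1 1 - q 0 1) := by linarith
    rw [z0, z1] at l3 l4
    nlinarith

/-! ### `Ω` is the set of realizable central configurations -/

lemma position_sub (a b c : ℝ) (ha : a ≠ 0) : position (a, b, c) 2 - position (a, b, c) 3 =
    ((b - c) / a) • (position (a, b, c) 1 - position (a, b, c) 0) := by
  ext i
  fin_cases i <;> simp [position, ha]

lemma cross_position (a b c : ℝ) :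
    cross (position (a, b, c) 1 - position (a, b, c) 0)
      (position (a, b, c) 3 - position (a, b, c) 0) = -a := by
  simp [cross, position]

lemma position_injective {a b c : ℝ} (ha : a ≠ 0) (hbc : b ≠ c) :
    Function.Injective (position (a, b, c)) := by
  intro i j h
  have h0 := congrArg (fun x : Plane => x 0) h
  have h1 := congrArg (fun x : Plane => x 1) h
  fin_cases i <;> fin_cases j <;> simp_all [position]

lemma convenientlyLabelled_of_mem_Omega {p : ℝ × ℝ × ℝ} (h : p ∈ Omega) :
    ConvenientlyLabelled (position p) := by
  obtain ⟨-, -, -, h1, h2, h3, h4, h5⟩ := h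
  exact ⟨h3, h5.trans (h4.trans h3), h4.trans h3, h4, h1⟩

lemma realizable_subset_Omega : Realizable ⊆ Omega := by
  rintro ⟨a, b, c⟩ ⟨ha, hcb, ⟨l1, l2, l3, l4, l5⟩, m, hm, hc⟩
  simp only at ha hcb
  have ha0 : 0 < a := by linarith
  obtain ⟨hD, g1, g2, g3, g4⟩ := hc.trapezoid (position_sub a b c ha0.ne')
    (div_pos (by linarith) ha0) (by rw [cross_position]; linarith)
  exact ⟨ha, hcb, hD, l5, g1, l1, l4, g3 l1⟩

/-- If the Dziobek determinant of the inverse cubes `sᵢⱼ` vanishes, then one multiplier `k` makes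
`(s₁₂ - k) (s₃₄ - k)`, `(s₁₃ - k) (s₂₄ - k)` and `(s₁₄ - k) (s₂₃ - k)` equal. It lies between
`s₁₃` and `s₁₂`, so that the masses computed from it are positive. -/
lemma exists_multiplier {s₁₂ s₁₃ s₁₄ s₂₃ s₂₄ s₃₄ : ℝ} (h0 : 0 < s₂₄) (h1 : s₂₄ ≤ s₁₃)
    (h2 : s₁₃ < s₁₂) (h3 : s₁₂ ≤ s₃₄)
    (hD : (s₁₂ - s₁₃) * (s₃₄ - s₂₃) * (s₁₄ - s₂₄) - (s₁₄ - s₁₂) * (s₃₄ - s₂₄) * (s₂₃ - s₁₃) = 0) :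
    ∃ k, 0 < k ∧ s₁₃ < k ∧ k < s₁₂ ∧ (s₁₂ - k) * (s₃₄ - k) = (s₁₃ - k) * (s₂₄ - k) ∧
      (s₁₂ - k) * (s₃₄ - k) = (s₁₄ - k) * (s₂₃ - k) := by
  have hden : 0 < s₁₂ + s₃₄ - s₁₃ - s₂₄ := by linarith
  set k := (s₁₂ * s₃₄ - s₁₃ * s₂₄) / (s₁₂ + s₃₄ - s₁₃ - s₂₄) with hk
  have hk' : k * (s₁₂ + s₃₄ - s₁₃ - s₂₄) = s₁₂ * s₃₄ - s₁₃ * s₂₄ := div_mul_cancel₀ _ hden.ne'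
  have k1 : s₁₃ < k := by
    rw [hk, lt_div_iff₀ hden]
    nlinarith [mul_pos (sub_pos.2 h2) (sub_pos.2 (h2.trans_le h3))]
  have k2 : k < s₁₂ := by
    rw [hk, div_lt_iff₀ hden]
    nlinarith [mul_pos (sub_pos.2 h2) (sub_pos.2 (h1.trans_lt h2))]
  clear_value k
  refine ⟨k, by linarith, k1, k2, by linear_combination -hk', ?_⟩
  refine mul_left_cancel₀ hden.ne' ?_
  linear_combination hD - (s₁₂ + s₃₄ - s₁₄ - s₂₃) * hk'

lemma Omega_subset_realizable : Omega ⊆ Realizable := by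
  rintro ⟨a, b, c⟩ h
  have hlab := convenientlyLabelled_of_mem_Omega h
  obtain ⟨ha, hcb, hD, h1, h2, h3, h4, h5⟩ := h
  simp only at ha hcb
  have ha0 : 0 < a := by linarith
  have hinj := position_injective ha0.ne' hcb.ne'
  refine ⟨ha, hcb, hlab, ?_⟩
  have hsub := position_sub a b c ha0.ne'
  set q := position (a, b, c)
  have hpos : ∀ i j, i ≠ j → 0 < dist (q i) (q j) := fun i j hij => dist_pos.2 (hinj.ne hij)
  have p01 := hpos 0 1 (by decide)
  have p02 := hpos 0 2 (by decide)
  have p03 := hpos 0 3 (by decide)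
  have p12 := hpos 1 2 (by decide)
  have p13 := hpos 1 3 (by decide)
  have p23 := hpos 2 3 (by decide)
  have hdz : dziobek q = dziobekPoly (dist (q 0) (q 1) ^ 3) (dist (q 0) (q 2) ^ 3)
      (dist (q 0) (q 3) ^ 3) (dist (q 1) (q 2) ^ 3) (dist (q 1) (q 3) ^ 3)
      (dist (q 2) (q 3) ^ 3) := rfl
  rw [hdz, dziobekPoly_inv (by positivity) (by positivity) (by positivity) (by positivity)
    (by positivity) (by positivity)] at hD
  obtain ⟨k, hk, k1, k2, e1, e2⟩ := exists_multiplier (by positivity)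
    (inv_anti₀ (by positivity) (pow_le_pow_left₀ p02.le h1 3))
    (inv_strictAnti₀ (by positivity) (pow_lt_pow_left₀ h2 p01.le (by norm_num)))
    (inv_anti₀ (by positivity) (pow_le_pow_left₀ p23.le (h5.trans (h4.trans h3)) 3))
    ((mul_eq_zero.1 hD).resolve_left (by positivity))
  have s02 : strength k q 0 2 < 0 := sub_neg.2 k1
  have s01 : 0 < strength k q 0 1 := sub_pos.2 k2
  have s12 : 0 < strength k q 1 2 := s01.trans_le (strength_le_strength h3 (hinj.ne (by decide)))
  have s03 : 0 < strength k q 0 3 := s12.trans_le (strength_le_strength h4 (hinj.ne (by decide)))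
  have s23 : 0 < strength k q 2 3 := s03.trans_le (strength_le_strength h5 (hinj.ne (by decide)))
  change strength k q 0 1 * strength k q 2 3 = strength k q 0 2 * strength k q 1 3 at e1
  change strength k q 0 1 * strength k q 2 3 = strength k q 0 3 * strength k q 1 2 at e2
  have hτ : 0 < (b - c) / a := div_pos (by linarith) ha0
  set τ := (b - c) / a
  set S := strength k q
  have hm : ∀ i, 0 < (![1, -S 0 2 / S 1 2, S 0 1 / (τ * S 1 2), -S 0 2 / (τ * S 2 3)]
      : Fin 4 → ℝ) i := by
    have : 0 < -S 0 2 := by linarith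
    intro i
    fin_cases i
    · exact one_pos
    · change 0 < -S 0 2 / S 1 2; positivity
    · change 0 < S 0 1 / (τ * S 1 2); positivity
    · change 0 < -S 0 2 / (τ * S 2 3); positivity
  refine ⟨![1, -S 0 2 / S 1 2, S 0 1 / (τ * S 1 2), -S 0 2 / (τ * S 2 3)], rfl, hm, hinj,
    centralEquations_of_scalarEquations hsub (Finset.sum_pos (fun i _ => hm i) (by simp)) hk ?_⟩
  change ScalarEquations _ S τ
  clear_value S τ
  constructor <;> simp <;> field_simp <;>
    first | linarith | linear_combination S 0 2 * e2

theorem realizable_eq_Omega : Realizable = Omega :=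
  realizable_subset_Omega.antisymm Omega_subset_realizable

/-! ### Relabelling and normalization of a trapezoid -/

lemma IsCentral.comp_perm {m : Fin 4 → ℝ} {q : Fin 4 → Plane} (h : IsCentral m q)
    (σ : Equiv.Perm (Fin 4)) : IsCentral (m ∘ σ) (q ∘ σ) := by
  obtain ⟨hm, hinj, hc⟩ := h
  have hM : 0 < ∑ i, m i := Finset.sum_pos (fun i _ => hm i) (by simp)
  obtain ⟨k, hk, hs⟩ := (centralEquations_iff q hM).1 hc
  refine ⟨fun i => hm _, hinj.comp σ.injective, (centralEquations_iff _ ?_).2 ⟨k, hk, fun i => ?_⟩⟩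
  · exact Finset.sum_pos (fun i _ => hm _) (by simp)
  · rw [← hs (σ i)]
    exact Equiv.sum_comp σ fun j => (m j * strength k q (σ i) j) • (q j - q (σ i))

/-- A trapezoid is brought by a similarity to the normalized position: the unit of length is the
distance between the lines of the bases. -/
lemma exists_position_of_trapezoid {q : Fin 4 → Plane} {τ : ℝ}
    (hq : q 2 - q 3 = τ • (q 1 - q 0)) (hx : cross (q 1 - q 0) (q 3 - q 0) ≠ 0) :
    ∃ h a c : ℝ, 0 < h ∧ 0 < a ∧ ∀ i j, dist (q i) (q j) =
      h * dist (position (a, c + τ * a, c) i) (position (a, c + τ * a, c) j) := by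
  set K := |cross (q 1 - q 0) (q 3 - q 0)| with hK
  have hKpos : 0 < K := abs_pos.2 hx
  have hK2 : K ^ 2 = ((q 1 0 - q 0 0) * (q 3 1 - q 0 1) - (q 1 1 - q 0 1) * (q 3 0 - q 0 0)) ^ 2 := by
    rw [hK, sq_abs, cross]; rfl
  set E := (q 1 0 - q 0 0) ^ 2 + (q 1 1 - q 0 1) ^ 2 with hE
  set W := (q 1 0 - q 0 0) * (q 3 0 - q 0 0) + (q 1 1 - q 0 1) * (q 3 1 - q 0 1) with hW
  have hEpos : 0 < E := by
    rcases eq_or_ne (q 1 0 - q 0 0) 0 with h0 | h0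
    · rcases eq_or_ne (q 1 1 - q 0 1) 0 with h1 | h1
      · rw [h0, h1] at hK2
        nlinarith
      · positivity
    · positivity
  -- the square of the length of the leg `q 0 q 3` is `(K ^ 2 + W ^ 2) / E`
  have hlag : E * ((q 3 0 - q 0 0) ^ 2 + (q 3 1 - q 0 1) ^ 2) = K ^ 2 + W ^ 2 := by
    rw [hK2, hE, hW]; ring
  refine ⟨K / √E, E / K, W / K, by positivity, by positivity, ?_⟩
  have c0 : q 2 0 - q 3 0 = τ * (q 1 0 - q 0 0) := by
    simpa using congrArg (fun x : Plane => x 0) hq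
  have c1 : q 2 1 - q 3 1 = τ * (q 1 1 - q 0 1) := by
    simpa using congrArg (fun x : Plane => x 1) hq
  have z0 : q 2 0 = q 3 0 + τ * (q 1 0 - q 0 0) := by linarith
  have z1 : q 2 1 = q 3 1 + τ * (q 1 1 - q 0 1) := by linarith
  have key : ∀ i j, E * dist (q i) (q j) ^ 2 =
      K ^ 2 * dist (position (E / K, W / K + τ * (E / K), W / K) i)
        (position (E / K, W / K + τ * (E / K), W / K) j) ^ 2 := by
    intro i j
    rw [dist_sq_eq, dist_sq_eq]
    fin_cases i <;> fin_cases j <;> simp [position, z0, z1] <;> field_simp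
    all_goals first | (rw [hK2, hE, hW]; ring) | (rw [hE, ← sub_eq_zero]; ring)
  intro i j
  refine (sq_eq_sq₀ dist_nonneg (by positivity)).1 ?_
  rw [mul_pow, div_pow, Real.sq_sqrt hEpos.le, div_mul_eq_mul_div, ← key]
  field_simp

/-- The case of a trapezoid labelled so that `q 0 q 1` is its longer base and `q 1 q 3` its longer
diagonal. The point is that no leg is longer than `q 0 q 1`: if `q 1 q 2` were, then `q 0 q 3` would
be the shortest side, and `2 a b < 1 + b ^ 2 < 2 b (b - c) ≤ 2 a b`. -/
lemma IsCentral.exists_similar_of_labelled {m : Fin 4 → ℝ} {q : Fin 4 → Plane} {τ : ℝ}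
    (h : IsCentral m q) (hq : q 2 - q 3 = τ • (q 1 - q 0)) (hτ : 0 < τ) (hτ1 : τ ≤ 1)
    (hx : cross (q 1 - q 0) (q 3 - q 0) ≠ 0) (hdiag : dist (q 0) (q 2) ≤ dist (q 1) (q 3)) :
    ∃ p ∈ Omega, Similar q (position p) := by
  obtain ⟨s, a, c, hs, ha, hd⟩ := exists_position_of_trapezoid hq hx
  obtain ⟨hD, g1, g2, g3, g4⟩ := h.trapezoid hq hτ hx
  have hd2 : 0 < τ * a := by positivity
  have hda : τ * a ≤ a := by nlinarith
  have hDp : dziobek (position (a, c + τ * a, c)) = 0 := by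
    refine (mul_eq_zero.1 (?_ : s ^ 9 * _ = 0)).resolve_left (by positivity)
    rw [← hD]
    simp only [dziobek, hd]
    ring
  refine ⟨(a, c + τ * a, c), ?_, ?_⟩
  · rw [mem_Omega_iff]
    simp only [hd, dist_position_01, dist_position_02, dist_position_03, dist_position_12,
      dist_position_13, dist_position_23, mul_le_mul_iff_right₀ hs, mul_lt_mul_iff_right₀ hs]
      at hdiag g1 g2 g3 g4
    rw [Real.sqrt_le_sqrt_iff (by positivity)] at hdiag
    rw [Real.sqrt_lt_sqrt_iff (by positivity)] at g1 g2
    rw [Real.sqrt_le_sqrt_iff (by positivity), Real.sqrt_le_sqrt_iff (by positivity)] at g3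
    rw [Real.sqrt_lt_sqrt_iff (by positivity), Real.sqrt_lt_sqrt_iff (by positivity)] at g4
    obtain ⟨b, hb⟩ : ∃ b, b = c + τ * a := ⟨_, rfl⟩
    obtain rfl : c = b - τ * a := by linarith
    obtain ⟨d, hdd⟩ : ∃ d, d = τ * a := ⟨_, rfl⟩
    simp only [← hdd, sub_add_cancel] at *
    have hb0 : 0 < b := by nlinarith
    have h1 : 1 + (a - b) ^ 2 ≤ a ^ 2 := by
      by_contra! hlt
      have := g4 hlt
      nlinarith
    have h2 := g3 h1
    have h3 : 0 ≤ a - b - (b - d) := by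
      by_contra! hlt
      nlinarith
    refine ⟨by nlinarith, by linarith, hDp, by linarith, g1, h1, by nlinarith, h2⟩
  · refine ⟨s.toNNReal, by simpa using hs, fun i j => ?_⟩
    rw [edist_dist, edist_dist, hd, ENNReal.ofReal_mul hs.le]
    rfl

lemma IsCentral.exists_similar_of_le_one {m : Fin 4 → ℝ} {q : Fin 4 → Plane} {τ : ℝ}
    (h : IsCentral m q) (hq : q 2 - q 3 = τ • (q 1 - q 0)) (hτ : 0 < τ) (hτ1 : τ ≤ 1)
    (hx : cross (q 1 - q 0) (q 3 - q 0) ≠ 0) :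
    ∃ σ : Equiv.Perm (Fin 4), ∃ p ∈ Omega, Similar (q ∘ σ) (position p) := by
  rcases le_total (dist (q 0) (q 2)) (dist (q 1) (q 3)) with hle | hle
  · exact ⟨1, h.exists_similar_of_labelled hq hτ hτ1 hx hle⟩
  · -- the reflection exchanging the two legs
    set σ : Equiv.Perm (Fin 4) := Equiv.swap 0 1 * Equiv.swap 2 3 with hσ
    have s0 : σ 0 = 1 := by decide
    have s1 : σ 1 = 0 := by decide
    have s2 : σ 2 = 3 := by decide
    have s3 : σ 3 = 2 := by decide
    have e2 : q 2 = q 3 + τ • (q 1 - q 0) := by rw [← hq]; abel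
    refine ⟨σ, (h.comp_perm σ).exists_similar_of_labelled (τ := τ) ?_ hτ hτ1 ?_ ?_⟩
    · simp only [Function.comp, s0, s1, s2, s3, e2]
      module
    · simp only [Function.comp, s0, s1, s3, e2]
      intro h0
      apply hx
      simp only [cross, PiLp.sub_apply, PiLp.add_apply, PiLp.smul_apply, smul_eq_mul] at h0 ⊢
      linear_combination -h0
    · simpa only [Function.comp, s0, s1, s2, s3] using hle

/-- Every trapezoid central configuration is similar to the configuration of a point of `Ω`. -/
theorem IsCentral.exists_similar_of_isTrapezoid {m : Fin 4 → ℝ} {q : Fin 4 → Plane}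
    (h : IsCentral m q) (hq : IsTrapezoid q) :
    ∃ σ : Equiv.Perm (Fin 4), ∃ p ∈ Omega, Similar (q ∘ σ) (position p) := by
  obtain ⟨ρ, t, ht, hpar, hcol⟩ := hq
  have hx := cross_ne_zero_of_not_collinear hcol
  have hpar' : q (ρ 2) - q (ρ 3) = t⁻¹ • (q (ρ 1) - q (ρ 0)) := by
    rw [hpar, smul_smul, inv_mul_cancel₀ ht.ne', one_smul]
  rcases le_total t⁻¹ 1 with hle | hle
  · obtain ⟨σ, p, hp, hs⟩ :=
      (h.comp_perm ρ).exists_similar_of_le_one hpar' (inv_pos.2 ht) hle hx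
    exact ⟨ρ * σ, p, hp, hs⟩
  · -- the rotation exchanging the two bases
    set π : Equiv.Perm (Fin 4) := Equiv.swap 0 2 * Equiv.swap 1 3 with hπ
    have s0 : π 0 = 2 := by decide
    have s1 : π 1 = 3 := by decide
    have s2 : π 2 = 0 := by decide
    have s3 : π 3 = 1 := by decide
    obtain ⟨σ, p, hp, hs⟩ :=
      ((h.comp_perm ρ).comp_perm π).exists_similar_of_le_one (τ := t) (by
        simp only [Function.comp, s0, s1, s2, s3]
        rw [← neg_sub, hpar, ← smul_neg, neg_sub]) ht ((one_le_inv₀ ht).1 hle) (by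
        simp only [Function.comp, s0, s1, s3]
        intro h0
        apply hx
        have e2 : q (ρ 2) = q (ρ 3) + t⁻¹ • (q (ρ 1) - q (ρ 0)) := by rw [← hpar']; abel
        rw [e2] at h0
        simp only [cross, PiLp.sub_apply, PiLp.add_apply, PiLp.smul_apply, smul_eq_mul] at h0 ⊢
        refine (mul_eq_zero.1 (?_ : t⁻¹ * _ = 0)).resolve_left (inv_pos.2 ht).ne'
        linear_combination h0)
    exact ⟨ρ * (π * σ), p, hp, hs⟩

/-! ### Isosceles trapezoids -/

lemma rpow_three_halves {x : ℝ} (hx : 0 ≤ x) : x ^ (3 / 2 : ℝ) = √x ^ 3 := by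
  rw [Real.sqrt_eq_rpow, ← Real.rpow_natCast, ← Real.rpow_mul hx]
  norm_num

lemma f_eq (b c : ℝ) : f b c =
    ((b + c) ^ 3 - √(1 + c ^ 2) ^ 3) * (√(1 + b ^ 2) ^ 3 - (b - c) ^ 3) -
      (√(1 + b ^ 2) ^ 3 - (b + c) ^ 3) * (√(1 + c ^ 2) ^ 3 - (b - c) ^ 3) := by
  rw [f, rpow_three_halves (by positivity), rpow_three_halves (by positivity), add_comm (b ^ 2),
    add_comm (c ^ 2)]

/-- The isosceles trapezoid with `a = b + c` has its diagonals longer than the base `q 0 q 1`, that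
base longer than the legs, and the legs longer than the other base. -/
structure IsosRegion (b c : ℝ) : Prop where
  lt : c < b
  leg_lt_base : √(1 + c ^ 2) < b + c
  base_lt_diag : b + c < √(1 + b ^ 2)
  base_lt_leg : b - c < √(1 + c ^ 2)

lemma three_mul_sq_lt_one {c : ℝ} (h : -1 / √3 < c) (h' : c < 1 / √3) : 3 * c ^ 2 < 1 := by
  have h3 : 0 < √3 := by positivity
  have hs : √3 ^ 2 = 3 := Real.sq_sqrt (by norm_num)
  rw [div_lt_iff₀ h3] at h
  rw [lt_div_iff₀ h3] at h'
  nlinarith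

/-- This inequality excludes the zeros of `f` at which the base `d` would be at least as long as the
legs `w` and the base `a` longer than the diagonals `v`. -/
lemma mul_sub_cubes_lt {a v w d : ℝ} (hw : 0 ≤ w) (hwd : w ≤ d) (hdv : d < v) (hva : v < a)
    (hav : 2 * (a - v) < a - d) :
    (a ^ 3 - v ^ 3) * (d ^ 3 - w ^ 3) < (a ^ 3 - w ^ 3) * (v ^ 3 - d ^ 3) := by
  have hd : 0 ≤ d := hw.trans hwd
  have hv : 0 < v := hd.trans_lt hdv
  have ha : 0 < a := hv.trans hva
  have hW : 0 ≤ w ^ 3 := by positivity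
  have hWD : w ^ 3 ≤ d ^ 3 := pow_le_pow_left₀ hw hwd 3
  have hDV : d ^ 3 < v ^ 3 := pow_lt_pow_left₀ hdv hd (by norm_num)
  have key : (a ^ 2 + a * v + v ^ 2) * (d ^ 3 - w ^ 3) ≤
      (a ^ 2 + a * d + d ^ 2) * (v ^ 3 - w ^ 3) := by
    have h1 : 0 ≤ w ^ 3 * ((v - d) * (a + v + d)) :=
      mul_nonneg hW (mul_nonneg (by linarith) (by linarith))
    have h2 : 0 ≤ a ^ 2 * (v ^ 3 - d ^ 3) := mul_nonneg (by positivity) (by linarith)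
    have h3 : 0 ≤ (v - d) * (a * d * v * (v + d) + d ^ 2 * v ^ 2) :=
      mul_nonneg (by linarith) (by positivity)
    nlinarith
  have h4 : 2 * (a - v) * ((a ^ 2 + a * v + v ^ 2) * (d ^ 3 - w ^ 3)) ≤
      2 * (a - v) * ((a ^ 2 + a * d + d ^ 2) * (v ^ 3 - w ^ 3)) :=
    mul_le_mul_of_nonneg_left key (by linarith)
  have h5 : 2 * (a - v) * ((a ^ 2 + a * d + d ^ 2) * (v ^ 3 - w ^ 3)) <
      (a - d) * ((a ^ 2 + a * d + d ^ 2) * (v ^ 3 - w ^ 3)) :=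
    mul_lt_mul_of_pos_right hav (mul_pos (by positivity) (by linarith))
  -- the difference of the two sides is `(a³ - d³) (v³ - w³) - 2 (a³ - v³) (d³ - w³)`
  linear_combination h4 + h5

/-- The zeros of `f` with `0 < c < 1 / √3` are in the region where the distances have the order
that a central configuration requires. -/
lemma isosRegion_of_f_eq_zero {b c : ℝ} (hc : 0 < c) (hc' : 3 * c ^ 2 < 1) (h : f b c = 0) :
    IsosRegion b c := by
  rw [f_eq] at h
  have hw1 : c < √(1 + c ^ 2) := Real.lt_sqrt_of_sq_lt (by linarith)
  have hw2 : 2 * c < √(1 + c ^ 2) := Real.lt_sqrt_of_sq_lt (by linarith)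
  have hv1 : b < √(1 + b ^ 2) := Real.lt_sqrt_of_sq_lt (by linarith)
  have hwv : c < b → √(1 + c ^ 2) < √(1 + b ^ 2) := fun h => Real.sqrt_lt_sqrt (by positivity)
    (by nlinarith)
  have hvpos : 0 < √(1 + b ^ 2) := Real.sqrt_pos.2 (by positivity)
  have hav : b ≤ c → b + c < √(1 + b ^ 2) := fun h => Real.lt_sqrt_of_sq_lt (by nlinarith)
  set w := √(1 + c ^ 2)
  set v := √(1 + b ^ 2)
  have cube : ∀ {x y : ℝ}, x < y → x ^ 3 < y ^ 3 := fun hxy =>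
    Odd.strictMono_pow (by decide) hxy
  have cube' : ∀ {x y : ℝ}, x ≤ y → x ^ 3 ≤ y ^ 3 := fun hxy =>
    (Odd.strictMono_pow (by decide)).monotone hxy
  rcases le_or_gt b c with hbc | hbc
  · exfalso
    have h1 := cube (show b + c < w by linarith)
    have h2 := cube (show b - c < v by linarith)
    have h3 := cube (hav hbc)
    have h4 := cube (show b - c < w by linarith)
    nlinarith [mul_pos (sub_pos.2 h1) (sub_pos.2 h2), mul_pos (sub_pos.2 h3) (sub_pos.2 h4)]
  have hwv := hwv hbc
  have h2 := cube (show b - c < v by linarith)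
  rcases lt_or_ge (b - c) w with hdw | hdw
  · have h4 := cube hdw
    have h5 := cube hwv
    refine ⟨hbc, ?_, ?_, hdw⟩
    · by_contra! hle
      have h1 := cube' hle
      nlinarith [mul_nonneg (sub_nonneg.2 h1) (sub_pos.2 h2).le,
        mul_pos (show 0 < v ^ 3 - (b + c) ^ 3 by linarith) (sub_pos.2 h4)]
    · by_contra! hle
      have h1 := cube' hle
      nlinarith [mul_nonneg (sub_nonneg.2 h1) (sub_pos.2 h4).le,
        mul_pos (show 0 < (b + c) ^ 3 - w ^ 3 by linarith) (sub_pos.2 h2)]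
  · exfalso
    have h1 := cube (show w < b + c by linarith)
    have h4 := cube' hdw
    rcases lt_or_ge v (b + c) with hva | hva
    · have := mul_sub_cubes_lt (a := b + c) (Real.sqrt_nonneg _) hdw (by linarith) hva
        (by linarith)
      linarith
    · have h3 := cube' hva
      nlinarith [mul_pos (sub_pos.2 h1) (sub_pos.2 h2),
        mul_nonneg (sub_nonneg.2 h3) (sub_nonneg.2 h4)]

/-- The cross-ratio `(1 - y) (x - z) / ((x - 1) (y - z))` increases if `y` decreases, `x` does not
increase and `z` does not decrease. -/
lemma crossRatio_lt {x y z x' y' z' : ℝ} (hx : x' ≤ x) (hy : y' < y) (hz : z ≤ z') (hx' : 1 < x')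
    (hy1 : y < 1) (hz' : z' < y') :
    ((1 - y) * (x - z)) * ((x' - 1) * (y' - z')) <
      ((1 - y') * (x' - z')) * ((x - 1) * (y - z)) := by
  have i1 : (x - z) * (x' - 1) ≤ (x' - z) * (x - 1) := by nlinarith
  have i2 : (1 - y) * (y' - z) < (1 - y') * (y - z) := by nlinarith
  have i3 : (x' - z) * (y' - z') ≤ (x' - z') * (y' - z) := by nlinarith
  have j1 : 0 < (x - z) * (x' - 1) := mul_pos (by linarith) (by linarith)
  have j2 : 0 < (1 - y) * (y' - z) := mul_pos (by linarith) (by linarith)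
  have j3 : 0 < (x' - z) * (y' - z') := mul_pos (by linarith) (by linarith)
  have hC : 0 < (x' - z) * (y' - z) := mul_pos (by linarith) (by linarith)
  refine lt_of_mul_lt_mul_right ?_ hC.le
  calc _ = ((1 - y) * (y' - z)) * (((x - z) * (x' - 1)) * ((x' - z) * (y' - z'))) := by ring
    _ < ((1 - y') * (y - z)) * (((x - z) * (x' - 1)) * ((x' - z) * (y' - z'))) :=
      mul_lt_mul_of_pos_right i2 (mul_pos j1 j3)
    _ ≤ ((1 - y') * (y - z)) * (((x' - z) * (x - 1)) * ((x' - z') * (y' - z))) :=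
      mul_le_mul_of_nonneg_left (mul_le_mul i1 i3 j3.le (j1.le.trans i1)) (j2.trans i2).le
    _ = _ := by ring

lemma f_eq_mul_crossRatio {b c : ℝ} (h : b + c ≠ 0) : f b c = (b + c) ^ 6 *
    ((1 - (√(1 + c ^ 2) / (b + c)) ^ 3) * ((√(1 + b ^ 2) / (b + c)) ^ 3 - ((b - c) / (b + c)) ^ 3) -
      ((√(1 + b ^ 2) / (b + c)) ^ 3 - 1) *
        ((√(1 + c ^ 2) / (b + c)) ^ 3 - ((b - c) / (b + c)) ^ 3)) := by
  rw [f_eq]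
  field_simp

/-- Along a segment of constant `c` in `IsosRegion`, the cross-ratio of which `f` measures the
distance from `1` is strictly monotone. -/
lemma IsosRegion.crossRatio_lt {b b' c : ℝ} (h : IsosRegion b c) (h' : IsosRegion b' c)
    (hc : 0 < c) (hb : b < b') :
    ((1 - (√(1 + c ^ 2) / (b + c)) ^ 3) *
        ((√(1 + b ^ 2) / (b + c)) ^ 3 - ((b - c) / (b + c)) ^ 3)) *
      (((√(1 + b' ^ 2) / (b' + c)) ^ 3 - 1) *
        ((√(1 + c ^ 2) / (b' + c)) ^ 3 - ((b' - c) / (b' + c)) ^ 3)) <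
    ((1 - (√(1 + c ^ 2) / (b' + c)) ^ 3) *
        ((√(1 + b' ^ 2) / (b' + c)) ^ 3 - ((b' - c) / (b' + c)) ^ 3)) *
      (((√(1 + b ^ 2) / (b + c)) ^ 3 - 1) *
        ((√(1 + c ^ 2) / (b + c)) ^ 3 - ((b - c) / (b + c)) ^ 3)) := by
  have hlt := h.lt
  have ha : 0 < b + c := by linarith
  have ha' : 0 < b' + c := by linarith
  have hw : 0 < √(1 + c ^ 2) := Real.sqrt_pos.2 (by positivity)
  have q1 : (b + c) ^ 2 < 1 + b ^ 2 := (Real.lt_sqrt ha.le).1 h.base_lt_diag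
  have q2 : (b' + c) ^ 2 < 1 + b' ^ 2 := (Real.lt_sqrt ha'.le).1 h'.base_lt_diag
  refine TrapezoidCC.crossRatio_lt ?_ ?_ ?_ ?_ ?_ ?_
  · refine pow_le_pow_left₀ (by positivity) ?_ 3
    rw [div_le_div_iff₀ ha' ha]
    refine (sq_le_sq₀ (by positivity) (by positivity)).1 ?_
    rw [mul_pow, mul_pow, Real.sq_sqrt (by positivity), Real.sq_sqrt (by positivity)]
    have h1 : 0 < (b + b') * (1 - c ^ 2) - 2 * c * b * b' := by
      nlinarith [mul_pos (show 0 < b' by linarith) (show 0 < 1 - c ^ 2 - 2 * b * c by linarith),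
        mul_pos (show 0 < b by linarith) (show 0 < 1 - c ^ 2 by nlinarith)]
    nlinarith [mul_pos (sub_pos.2 hb) (show 0 < (b + b') * (1 - c ^ 2) + 2 * c * (1 - b * b') by
      linarith)]
  · refine pow_lt_pow_left₀ ?_ (by positivity) (by norm_num)
    exact div_lt_div_of_pos_left hw ha (by linarith)
  · refine pow_le_pow_left₀ (div_nonneg (by linarith) ha.le) ?_ 3
    rw [div_le_div_iff₀ ha ha']
    nlinarith
  · exact one_lt_pow₀ ((one_lt_div ha').2 h'.base_lt_diag) (by norm_num)
  · exact pow_lt_one₀ (by positivity) ((div_lt_one ha).2 h.leg_lt_base) (by norm_num)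
  · refine pow_lt_pow_left₀ ?_ (div_nonneg (by linarith) ha'.le) (by norm_num)
    exact div_lt_div_of_pos_right h'.base_lt_leg ha'

lemma IsosRegion.crossRatio_pos {b c : ℝ} (h : IsosRegion b c) (hc : 0 < c) :
    0 < ((√(1 + b ^ 2) / (b + c)) ^ 3 - 1) *
        ((√(1 + c ^ 2) / (b + c)) ^ 3 - ((b - c) / (b + c)) ^ 3) := by
  have hlt := h.lt
  have ha : 0 < b + c := by linarith
  refine mul_pos (sub_pos.2 (one_lt_pow₀ ((one_lt_div ha).2 h.base_lt_diag) (by norm_num)))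
    (sub_pos.2 (pow_lt_pow_left₀ ?_ (div_nonneg (by linarith) ha.le) (by norm_num)))
  exact div_lt_div_of_pos_right h.base_lt_leg ha

lemma IsosRegion.f_pos {b b' c : ℝ} (h : IsosRegion b c) (h' : IsosRegion b' c)
    (hc : 0 < c) (hb : b < b') (h0 : f b c = 0) : 0 < f b' c := by
  have hlt := h.lt
  have ha : 0 < b + c := by linarith
  have ha' : 0 < b' + c := by linarith
  have h1 := h.crossRatio_lt h' hc hb
  rw [f_eq_mul_crossRatio ha.ne', mul_eq_zero, or_iff_right (by positivity), sub_eq_zero] at h0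
  rw [f_eq_mul_crossRatio ha'.ne']
  rw [h0, mul_comm] at h1
  exact mul_pos (by positivity) (sub_pos.2 (lt_of_mul_lt_mul_right h1 (h.crossRatio_pos hc).le))

lemma IsosRegion.f_neg {b b' c : ℝ} (h : IsosRegion b c) (h' : IsosRegion b' c)
    (hc : 0 < c) (hb : b < b') (h0 : f b' c = 0) : f b c < 0 := by
  have hlt := h.lt
  have ha : 0 < b + c := by linarith
  have ha' : 0 < b' + c := by linarith
  have h1 := h.crossRatio_lt h' hc hb
  rw [f_eq_mul_crossRatio ha'.ne', mul_eq_zero, or_iff_right (by positivity), sub_eq_zero] at h0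
  rw [f_eq_mul_crossRatio ha.ne']
  rw [h0, mul_comm] at h1
  exact mul_neg_of_pos_of_neg (by positivity)
    (sub_neg.2 (lt_of_mul_lt_mul_left h1 (h'.crossRatio_pos hc).le))

lemma IsosRegion.eventually {b c : ℝ} (h : IsosRegion b c) : ∀ᶠ x in 𝓝 b, IsosRegion x c := by
  have h1 : ∀ᶠ x in 𝓝 b, c < x := continuousAt_id.eventually (lt_mem_nhds h.lt)
  have h2 : ∀ᶠ x in 𝓝 b, √(1 + c ^ 2) < x + c :=
    (show ContinuousAt (fun x => x + c) b by fun_prop).eventually (lt_mem_nhds h.leg_lt_base)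
  have h3 : ∀ᶠ x in 𝓝 b, x + c < √(1 + x ^ 2) :=
    (show ContinuousAt (fun x => x + c) b by fun_prop).eventually_lt
      (show ContinuousAt (fun x => √(1 + x ^ 2)) b by fun_prop) h.base_lt_diag
  have h4 : ∀ᶠ x in 𝓝 b, x - c < √(1 + c ^ 2) :=
    (show ContinuousAt (fun x => x - c) b by fun_prop).eventually (gt_mem_nhds h.base_lt_leg)
  filter_upwards [h1, h2, h3, h4] with x a b c d using ⟨a, b, c, d⟩

/-- On the plane of isosceles trapezoids, the Dziobek expression is a multiple of `f`. -/
lemma dziobek_isosceles {b c : ℝ} (h1 : 0 ≤ b + c) (h2 : c ≤ b) :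
    dziobek (position (b + c, b, c)) =
      -((cubeOfSq (1 + b ^ 2) - cubeOfSq (1 + c ^ 2)) * f b c) := by
  rw [dziobek_position, f_eq]
  have e1 : cubeOfSq ((b + c) ^ 2) = (b + c) ^ 3 := by rw [cubeOfSq, Real.sqrt_sq h1]
  have e2 : cubeOfSq ((b - c) ^ 2) = (b - c) ^ 3 := by
    rw [cubeOfSq, Real.sqrt_sq (sub_nonneg.2 h2)]
  rw [e1, e2, show b + c - b = c by ring, show b + c - c = b by ring]
  simp only [cubeOfSq, dziobekPoly]
  ring

lemma IsosRegion.mem_Omega {b c : ℝ} (h : IsosRegion b c) (h0 : f b c = 0) :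
    (b + c, b, c) ∈ Omega := by
  obtain ⟨h1, h2, h3, h4⟩ := h
  have hw : 1 ≤ √(1 + c ^ 2) := Real.one_le_sqrt.2 (by nlinarith)
  have q1 := (Real.lt_sqrt (by linarith)).1 h3
  have q2 := (Real.sqrt_lt' (by linarith)).1 h2
  have q3 := (Real.lt_sqrt (by linarith)).1 h4
  rw [mem_Omega_iff]
  refine ⟨by linarith, h1, ?_, by simp, q1, ?_, by simp, by linarith⟩
  · rw [dziobek_isosceles (by linarith) h1.le, h0]; simp
  · simpa using q2.le

/-! ### Relative boundaries and zeros on segments -/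

lemma mem_relBoundary_iff {X : Type*} [TopologicalSpace X] {S A : Set X} {x : X} :
    x ∈ relBoundary S A ↔ x ∈ S ∧ x ∈ closure (S ∩ A) ∧ x ∈ closure (S \ A) := by
  have key : ∀ y : S, y ∈ frontier (((↑) : S → X) ⁻¹' A) ↔
      (y : X) ∈ closure (S ∩ A) ∧ (y : X) ∈ closure (S \ A) := by
    intro y
    rw [frontier_eq_closure_inter_closure, mem_inter_iff, closure_subtype, closure_subtype,
      ← preimage_compl, Subtype.image_preimage_coe, Subtype.image_preimage_coe, sdiff_eq]
  constructor
  · rintro ⟨y, hy, rfl⟩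
    exact ⟨y.2, (key y).1 hy⟩
  · rintro ⟨hx, h⟩
    exact ⟨⟨x, hx⟩, (key ⟨x, hx⟩).2 h, rfl⟩

/-- A point is in the closure of the zeros of `F` with the property `T` if arbitrarily near to it
there are segments on which `F` changes its sign and whose zeros of `F` have the property `T`. -/
lemma mem_closure_zeros {E : Type*} [NormedAddCommGroup E] [NormedSpace ℝ E] {F : E → ℝ}
    (hF : Continuous F) {T : E → Prop} {p : E}
    (h : ∀ ε > 0, ∃ x ∈ Metric.ball p ε, ∃ y ∈ Metric.ball p ε, F x ≤ 0 ∧ 0 ≤ F y ∧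
      ∀ z ∈ segment ℝ x y, F z = 0 → T z) : p ∈ closure {z | F z = 0 ∧ T z} := by
  rw [Metric.mem_closure_iff]
  intro ε hε
  obtain ⟨x, hx, y, hy, hFx, hFy, hT⟩ := h ε hε
  obtain ⟨z, hz, hz0⟩ := (convex_segment x y).isPreconnected.intermediate_value
    (left_mem_segment ℝ x y) (right_mem_segment ℝ x y) hF.continuousOn ⟨hFx, hFy⟩
  refine ⟨z, ⟨hz0, hT z hz hz0⟩, ?_⟩
  rw [dist_comm]
  exact (convex_ball p ε).segment_subset hx hy hz

lemma mem_closure_zeros_of_tendsto {E : Type*} [NormedAddCommGroup E] [NormedSpace ℝ E] {F : E → ℝ}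
    (hF : Continuous F) {T : E → Prop} {p : E} {ι : Type*} {l : Filter ι} [l.NeBot] {x y : ι → E}
    (hx : Tendsto x l (𝓝 p)) (hy : Tendsto y l (𝓝 p))
    (h : ∀ᶠ i in l, F (x i) ≤ 0 ∧ 0 ≤ F (y i) ∧ ∀ z ∈ segment ℝ (x i) (y i), F z = 0 → T z) :
    p ∈ closure {z | F z = 0 ∧ T z} := by
  refine mem_closure_zeros hF fun ε hε => ?_
  obtain ⟨i, ⟨h1, h2⟩, h3⟩ := ((hx.eventually (Metric.ball_mem_nhds p hε)).and
    (hy.eventually (Metric.ball_mem_nhds p hε))).and h |>.exists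
  exact ⟨x i, h1, y i, h2, h3⟩

lemma mem_closure_sdiff_of_zeros {p : ℝ × ℝ × ℝ}
    (h : p ∈ closure {z | dziobek (position z) = 0 ∧ z ∉ Omega}) :
    p ∈ closure (dziobekSurface \ Omega) := h

lemma Omega_subset_surface : Omega ⊆ dziobekSurface := fun _ h => h.2.2.1

/-! ### Factorizations of the Dziobek polynomial for equal distances -/

lemma dziobekPoly_of_eq_12_23 (s u₁₃ u₁₄ u₂₄ u₃₄ : ℝ) :
    dziobekPoly s u₁₃ u₁₄ s u₂₄ u₃₄ = (u₁₃ - s) * (u₂₄ - s) * (u₁₄ - u₃₄) := by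
  unfold dziobekPoly; ring

lemma dziobekPoly_of_eq_14_34 (s u₁₂ u₁₃ u₂₃ u₂₄ : ℝ) :
    dziobekPoly u₁₂ u₁₃ s u₂₃ u₂₄ s = (u₂₄ - s) * (u₁₃ - s) * (u₂₃ - u₁₂) := by
  unfold dziobekPoly; ring

lemma dziobekPoly_of_eq_12_13 (s u₁₄ u₂₃ u₂₄ u₃₄ : ℝ) :
    dziobekPoly s s u₁₄ u₂₃ u₂₄ u₃₄ = -((s - u₁₄) * (u₂₄ - u₃₄) * (s - u₂₃)) := by
  unfold dziobekPoly; ring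

/-! ### Points of the surface near the boundary curves -/

lemma mem_Omega_of_rhombus {a b c : ℝ} (ha : 1 ≤ a) (hb : b = c + a) (hac : a ^ 2 = 1 + c ^ 2)
    (hc : c ≤ 0) (hc' : 3 * c ^ 2 < 1) : (a, b, c) ∈ Omega := by
  subst hb
  rw [mem_Omega_iff]
  refine ⟨ha, by linarith, ?_, by nlinarith, by nlinarith, by nlinarith, by nlinarith,
    by nlinarith⟩
  rw [dziobek_position, show a - (c + a) = -c by ring, show c + a - c = a by ring, neg_sq,
    ← hac, dziobekPoly_of_eq_12_23]
  ring

/-- Near a rhombus, there are solutions of the Dziobek equation with `r₁₂ < r₂₃` or `r₁₄ < r₃₄`. -/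
lemma mem_closure_sdiff_of_rhombus {a b c : ℝ} (ha : 1 ≤ a) (hb : b = c + a)
    (hac : a ^ 2 = 1 + c ^ 2) (hc : c ≤ 0) (hc' : 3 * c ^ 2 < 1) :
    (a, b, c) ∈ closure (dziobekSurface \ Omega) := by
  have hbpos : 0 < b := by nlinarith
  have hac2 : 0 < a + 2 * c := by nlinarith
  have hbc : c ^ 2 < b ^ 2 := by nlinarith
  refine mem_closure_sdiff_of_zeros (mem_closure_zeros_of_tendsto (l := 𝓝[>] (0 : ℝ))
    continuous_dziobek_position (x := fun ε => (a, b, c - ε)) (y := fun ε => (a - ε, b, c)) ?_ ?_ ?_)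
  · exact tendsto_nhdsWithin_of_tendsto_nhds
      (Continuous.tendsto' (by fun_prop) _ _ (by simp))
  · exact tendsto_nhdsWithin_of_tendsto_nhds
      (Continuous.tendsto' (by fun_prop) _ _ (by simp))
  · filter_upwards [Ioo_mem_nhdsGT (show (0 : ℝ) < 1 by norm_num)] with ε hε
    obtain ⟨h0, h1⟩ := hε
    have e1 : 1 + (a - b) ^ 2 = a ^ 2 := by rw [hb, hac]; ring
    have e2 : (b - c) ^ 2 = 1 + c ^ 2 := by rw [hb, ← hac]; ring
    refine ⟨?_, ?_, ?_⟩
    · rw [dziobek_position, e1, dziobekPoly_of_eq_12_23]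
      refine mul_nonpos_of_nonneg_of_nonpos (mul_nonneg ?_ ?_) ?_
      · exact sub_nonneg.2 (cubeOfSq_le (by linarith))
      · have := sq_le_sq' (show -(a - (c - ε)) ≤ c by linarith) (by linarith)
        exact sub_nonneg.2 (cubeOfSq_le (by linarith))
      · exact sub_nonpos.2 (cubeOfSq_le (by linarith [mul_pos hbpos h0]))
    · rw [dziobek_position, e2, dziobekPoly_of_eq_14_34]
      refine mul_nonneg (mul_nonneg ?_ ?_) ?_
      · have := sq_le_sq' (show -(a - ε - c) ≤ c by linarith) (by linarith)
        exact sub_nonneg.2 (cubeOfSq_le (by linarith))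
      · exact sub_nonneg.2 (cubeOfSq_le (by linarith))
      · exact sub_nonneg.2 (cubeOfSq_le (by linarith [mul_pos hbpos h0]))
    · rintro z ⟨s, t, hs, ht, hst, rfl⟩ -
      have hz : s • (a, b, c - ε) + t • (a - ε, b, c) = (a - t * ε, b, c - s * ε) := by
        obtain rfl : s = 1 - t := by linarith
        simp only [Prod.smul_mk, Prod.mk_add_mk, smul_eq_mul]
        ring_nf
      rw [hz, mem_Omega_iff]
      rintro ⟨-, -, -, -, -, i1, -, i2⟩
      -- the two inequalities say `1 + b ^ 2 ≤ 2 a b` and `b ^ 2 - 1 ≤ 2 b c` at the point `z`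
      have j1 : b * (t * ε) ≤ 0 := by linarith
      have j2 : b * (s * ε) ≤ 0 := by linarith
      have : 0 < b * ε := by positivity
      have : b * (s * ε) + b * (t * ε) = b * ε := by linear_combination (b * ε) * hst
      linarith

/-- Each point with an equilateral triangle `q₁ q₂ q₃` is a limit of points of `Ω`: for `x` slightly
larger than `b`, the Dziobek expression is negative where `r₁₂ = r₁₃` and positive where
`r₁₂ = r₂₃`, and between these two points `r₁₃ > r₁₂ > r₂₃`. -/
lemma mem_closure_Omega_of_equilateral {a b c : ℝ} (hb : 0 < b) (hb2 : 3 * b ^ 2 = 1)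
    (ha : a = 2 * b) (hc1 : -b < c) (hc2 : c < b) : (a, b, c) ∈ closure Omega := by
  have hOm : closure {z | dziobek (position z) = 0 ∧ z ∈ Omega} ⊆ closure Omega :=
    closure_mono fun _ h => h.2
  refine hOm (mem_closure_zeros_of_tendsto (l := 𝓝[>] b) continuous_dziobek_position
    (x := fun x => (√(1 + x ^ 2), x, c)) (y := fun x => ((1 + x ^ 2) / (2 * x), x, c)) ?_ ?_ ?_)
  · refine tendsto_nhdsWithin_of_tendsto_nhds (Continuous.tendsto' (by fun_prop) _ _ ?_)
    rw [ha, show 1 + b ^ 2 = (2 * b) ^ 2 by linarith, Real.sqrt_sq (by linarith)]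
  · have h1 : (1 + b ^ 2) / (2 * b) = a := by
      rw [div_eq_iff (by positivity)]; rw [ha]; linarith
    have h2 : ContinuousAt (fun x : ℝ => ((1 + x ^ 2) / (2 * x), x, c)) b := by
      have : 2 * b ≠ 0 := by positivity
      fun_prop (disch := assumption)
    have h3 := h2.tendsto
    rw [h1] at h3
    exact tendsto_nhdsWithin_of_tendsto_nhds h3
  · have h2 : ContinuousAt (fun x : ℝ => (1 + x ^ 2) / (2 * x) - x) b := by
      have : 2 * b ≠ 0 := by positivity
      fun_prop (disch := assumption)
    have hlim : (1 + b ^ 2) / (2 * b) - b = b := by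
      rw [sub_eq_iff_eq_add, div_eq_iff (by positivity)]; linarith
    have k1 : ∀ᶠ x in 𝓝 b, c < (1 + x ^ 2) / (2 * x) - x :=
      h2.eventually (lt_mem_nhds (hc2.trans_eq hlim.symm))
    have k2 : ∀ᶠ x in 𝓝 b, -c < (1 + x ^ 2) / (2 * x) - x :=
      h2.eventually (lt_mem_nhds ((neg_lt.1 hc1).trans_eq hlim.symm))
    have k3 : ∀ᶠ x in 𝓝 b, (x - c) ^ 2 < 1 + c ^ 2 :=
      (show ContinuousAt (fun x => (x - c) ^ 2) b by fun_prop).eventually (gt_mem_nhds (by nlinarith))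
    filter_upwards [nhdsWithin_le_nhds k1, nhdsWithin_le_nhds k2, nhdsWithin_le_nhds k3,
      self_mem_nhdsWithin] with x hx1 hx2 hx3 hx4
    have hx4 : b < x := hx4
    have hx0 : 0 < x := hb.trans hx4
    obtain ⟨l, hl⟩ : ∃ l, l = (1 + x ^ 2) / (2 * x) := ⟨_, rfl⟩
    rw [← hl] at hx1 hx2 ⊢
    have hl' : 2 * (l * x) = 1 + x ^ 2 := by
      rw [hl]; field_simp
    have hl0 : 0 < l := by rw [hl]; positivity
    obtain ⟨r, hr⟩ : ∃ r, r = √(1 + x ^ 2) := ⟨_, rfl⟩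
    rw [← hr]
    have hr2 : r ^ 2 = 1 + x ^ 2 := by rw [hr, Real.sq_sqrt (by positivity)]
    have hr0 : 0 ≤ r := by rw [hr]; positivity
    have hlr : l ^ 2 < 1 + x ^ 2 := by
      have : l < 2 * x := by nlinarith
      nlinarith
    have hlr' : l < r := by nlinarith
    have hl1 : 1 ≤ l := by nlinarith [sq_nonneg (x - 1)]
    have hcx : c ^ 2 < x ^ 2 := by
      rw [sq_lt_sq, abs_of_pos hx0, abs_lt]
      exact ⟨by linarith, by linarith⟩
    have hyc : ∀ {y}, l ≤ y → x ^ 2 ≤ (y - c) ^ 2 := fun hy =>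
      pow_le_pow_left₀ hx0.le (by linarith) 2
    have hDr : dziobek (position (r, x, c)) < 0 := by
      rw [dziobek_position, hr2, dziobekPoly_of_eq_12_13]
      refine neg_neg_of_pos (mul_pos (mul_pos ?_ ?_) ?_)
      · exact sub_pos.2 (cubeOfSq_lt (by positivity) (by linarith))
      · exact sub_pos.2 (cubeOfSq_lt (by positivity) (by linarith [hyc hlr'.le]))
      · exact sub_pos.2 (cubeOfSq_lt (by positivity)
          (by linarith [mul_pos (sub_pos.2 hlr') hx0, sub_sq r x]))
    refine ⟨hDr.le, ?_, ?_⟩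
    · rw [dziobek_position, show 1 + (l - x) ^ 2 = l ^ 2 by linarith, dziobekPoly_of_eq_12_23]
      refine mul_nonneg (mul_nonneg ?_ ?_) ?_
      · exact sub_nonneg.2 (cubeOfSq_le (by linarith))
      · exact sub_nonneg.2 (cubeOfSq_le (by linarith [hyc le_rfl]))
      · exact sub_nonneg.2 (cubeOfSq_le (by linarith))
    · rintro z ⟨s, t, hs, ht, hst, rfl⟩ hz0
      have hz : s • (r, x, c) + t • (l, x, c) = (s * r + t * l, x, c) := by
        obtain rfl : s = 1 - t := by linarith
        simp only [Prod.smul_mk, Prod.mk_add_mk, smul_eq_mul]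
        ring_nf
      rw [hz] at hz0 ⊢
      obtain ⟨y, hy⟩ : ∃ y, y = s * r + t * l := ⟨_, rfl⟩
      rw [← hy] at hz0 ⊢
      have hyl : l ≤ y := by
        have : y = l + s * (r - l) := by linear_combination hy + l * hst
        linarith [mul_nonneg hs (sub_pos.2 hlr').le]
      have hyr : y ≤ r := by
        have : y = r - t * (r - l) := by linear_combination hy + r * hst
        linarith [mul_nonneg ht (sub_pos.2 hlr').le]
      have hyr' : y < r := by
        refine lt_of_le_of_ne hyr ?_
        rintro rfl
        exact hDr.ne hz0
      rw [mem_Omega_iff]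
      refine ⟨by linarith, by linarith, hz0, hyc hyl, ?_, ?_, ?_, hx3.le⟩
      · rw [← hr2]
        exact pow_lt_pow_left₀ hyr' (by linarith) (by norm_num)
      · linarith [mul_nonneg (sub_nonneg.2 hyl) hx0.le, sub_sq y x]
      · rw [sq_le_sq, abs_of_nonneg (show 0 ≤ y - x by linarith), abs_le]
        exact ⟨by linarith, by linarith⟩

/-- Near an isosceles trapezoid, there are solutions of the Dziobek equation with `r₂₄ < r₁₃`. -/
lemma mem_closure_sdiff_of_isosceles {b c : ℝ} (h : IsosRegion b c) (hc : 0 < c) (h0 : f b c = 0) :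
    (b + c, b, c) ∈ closure (dziobekSurface \ Omega) := by
  refine mem_closure_sdiff_of_zeros (mem_closure_zeros continuous_dziobek_position fun ε hε => ?_)
  have hb := h.lt
  have hball : ∀ᶠ x in 𝓝 b, (x + c, x, c) ∈ Metric.ball (b + c, b, c) ε :=
    (show ContinuousAt (fun x => (x + c, x, c)) b by fun_prop).eventually
      (Metric.isOpen_ball.mem_nhds (Metric.mem_ball_self hε))
  have hev := h.eventually.and hball
  obtain ⟨b₁, ⟨r1, m1⟩, hb1⟩ :=
    ((hev.filter_mono (nhdsWithin_le_nhds (s := Iio b))).and self_mem_nhdsWithin).exists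
  obtain ⟨b₂, ⟨r2, m2⟩, hb2⟩ :=
    ((hev.filter_mono (nhdsWithin_le_nhds (s := Ioi b))).and self_mem_nhdsWithin).exists
  have hb1 : b₁ < b := hb1
  have hb2 : b < b₂ := hb2
  have hN : ∀ {x}, c < x → 0 < cubeOfSq (1 + x ^ 2) - cubeOfSq (1 + c ^ 2) := fun hx =>
    sub_pos.2 (cubeOfSq_lt (by positivity) (by nlinarith))
  have d1 : 0 < dziobek (position (b₁ + c, b₁, c)) := by
    have := r1.lt
    rw [dziobek_isosceles (by linarith) r1.lt.le]
    exact neg_pos.2 (mul_neg_of_pos_of_neg (hN r1.lt) (r1.f_neg h hc hb1 h0))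
  have d2 : dziobek (position (b₂ + c, b₂, c)) < 0 := by
    have := r2.lt
    rw [dziobek_isosceles (by linarith) r2.lt.le]
    exact neg_neg_of_pos (mul_pos (hN r2.lt) (h.f_pos r2 hc hb2 h0))
  -- shorten the base `q₁ q₂` a little, keeping the signs
  have cont : ∀ x : ℝ, Continuous fun δ : ℝ => (x + c - δ, x, c) := fun x => by fun_prop
  have tend : ∀ x : ℝ, Tendsto (fun δ : ℝ => (x + c - δ, x, c)) (𝓝 0) (𝓝 (x + c, x, c)) :=
    fun x => (cont x).tendsto' _ _ (by simp)
  have t1 := (tend b₁).eventually (Metric.isOpen_ball.mem_nhds m1)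
  have t2 := (tend b₂).eventually (Metric.isOpen_ball.mem_nhds m2)
  have t3 := (tend b₁).eventually (continuous_dziobek_position.continuousAt.eventually
    (lt_mem_nhds d1))
  have t4 := (tend b₂).eventually (continuous_dziobek_position.continuousAt.eventually
    (gt_mem_nhds d2))
  obtain ⟨δ, ⟨⟨s1, s2⟩, s3, s4⟩, hδ⟩ :=
    ((((t1.and t2).and (t3.and t4)).filter_mono (nhdsWithin_le_nhds (s := Ioi 0))).and
      self_mem_nhdsWithin).exists
  have hδ : 0 < δ := hδ
  refine ⟨_, s2, _, s1, s4.le, s3.le, ?_⟩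
  rintro z ⟨s, t, hs, ht, hst, rfl⟩ -
  have hz : s • (b₂ + c - δ, b₂, c) + t • (b₁ + c - δ, b₁, c) =
      (s * b₂ + t * b₁ + c - δ, s * b₂ + t * b₁, c) := by
    obtain rfl : s = 1 - t := by linarith
    simp only [Prod.smul_mk, Prod.mk_add_mk, smul_eq_mul]
    ring_nf
  rw [hz, mem_Omega_iff]
  obtain ⟨y, hy⟩ : ∃ y, y = s * b₂ + t * b₁ := ⟨_, rfl⟩
  rw [← hy]
  rintro ⟨i1, i2, -, i3, -⟩
  nlinarith

/-! ### The boundary of `Ω` in the surface -/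

lemma cubeOfSq_inj {x y : ℝ} (hx : 0 ≤ x) (hy : 0 ≤ y) : cubeOfSq x = cubeOfSq y ↔ x = y := by
  refine ⟨fun h => ?_, fun h => h ▸ rfl⟩
  by_contra hne
  rcases lt_or_gt_of_ne hne with hlt | hlt
  · exact (cubeOfSq_lt hx hlt).ne h
  · exact (cubeOfSq_lt hy hlt).ne' h

lemma le_of_mem_closure_Omega {a b c : ℝ} (h : (a, b, c) ∈ closure Omega) :
    1 ≤ a ∧ c ≤ b ∧ b ^ 2 ≤ (a - c) ^ 2 ∧ a ^ 2 ≤ 1 + b ^ 2 ∧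
      1 + (a - b) ^ 2 ≤ a ^ 2 ∧ c ^ 2 ≤ (a - b) ^ 2 ∧ (b - c) ^ 2 ≤ 1 + c ^ 2 := by
  have key : closure Omega ⊆ {p : ℝ × ℝ × ℝ | 1 ≤ p.1 ∧ p.2.2 ≤ p.2.1 ∧
      p.2.1 ^ 2 ≤ (p.1 - p.2.2) ^ 2 ∧ p.1 ^ 2 ≤ 1 + p.2.1 ^ 2 ∧
      1 + (p.1 - p.2.1) ^ 2 ≤ p.1 ^ 2 ∧ p.2.2 ^ 2 ≤ (p.1 - p.2.1) ^ 2 ∧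
      (p.2.1 - p.2.2) ^ 2 ≤ 1 + p.2.2 ^ 2} := by
    refine closure_minimal ?_ ?_
    · rintro ⟨a, b, c⟩ h
      obtain ⟨h1, h2, -, h3, h4, h5, h6, h7⟩ := (mem_Omega_iff a b c).1 h
      exact ⟨h1, h2.le, h3, h4.le, h5, h6, h7⟩
    · repeat' refine IsClosed.and ?_ ?_
      all_goals apply isClosed_le <;> fun_prop
  exact key h

/-- Where all the inequalities that define `Ω` are strict, `Ω` is a neighbourhood in the surface. -/
lemma not_mem_closure_sdiff_of_lt {a b c : ℝ} (h1 : 1 < a) (h2 : c < b)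
    (h3 : b ^ 2 < (a - c) ^ 2) (h4 : a ^ 2 < 1 + b ^ 2) (h5 : 1 + (a - b) ^ 2 < a ^ 2)
    (h6 : c ^ 2 < (a - b) ^ 2) (h7 : (b - c) ^ 2 < 1 + c ^ 2) :
    (a, b, c) ∉ closure (dziobekSurface \ Omega) := by
  set U : Set (ℝ × ℝ × ℝ) := {p : ℝ × ℝ × ℝ | 1 < p.1 ∧ p.2.2 < p.2.1 ∧
      p.2.1 ^ 2 < (p.1 - p.2.2) ^ 2 ∧ p.1 ^ 2 < 1 + p.2.1 ^ 2 ∧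
      1 + (p.1 - p.2.1) ^ 2 < p.1 ^ 2 ∧ p.2.2 ^ 2 < (p.1 - p.2.1) ^ 2 ∧
      (p.2.1 - p.2.2) ^ 2 < 1 + p.2.2 ^ 2} with hU
  have hUo : IsOpen U := by
    repeat' refine IsOpen.and ?_ ?_
    all_goals apply isOpen_lt <;> fun_prop
  intro hcl
  obtain ⟨⟨x, y, z⟩, ⟨g1, g2, g3, g4, g5, g6, g7⟩, hD, hn⟩ :=
    mem_closure_iff.1 hcl U hUo ⟨h1, h2, h3, h4, h5, h6, h7⟩
  exact hn ((mem_Omega_iff x y z).2 ⟨g1.le, g2, hD, g3.le, g4, g5.le, g6.le, g7.le⟩)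

lemma eq_one_div_sqrt_three {b : ℝ} (hb : 0 < b) (h : 3 * b ^ 2 = 1) : b = 1 / √3 := by
  rw [eq_div_iff (by positivity)]
  refine (sq_eq_sq₀ (by positivity) (by norm_num)).1 ?_
  rw [mul_pow, Real.sq_sqrt (by norm_num)]
  linarith

lemma abs_lt_one_div_sqrt_three {c : ℝ} (h : 3 * c ^ 2 < 1) : -1 / √3 < c ∧ c < 1 / √3 := by
  have : c ^ 2 < (1 / √3) ^ 2 := by
    rw [div_pow, Real.sq_sqrt (by norm_num)]; linarith
  rw [sq_lt_sq, abs_of_pos (show 0 < 1 / √3 by positivity), abs_lt] at this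
  rw [neg_div]
  exact this

/-- The points for which `q₁ q₂ q₃` is equilateral and `q₄` is between the two extreme positions
`P1` and `P2`. -/
lemma mem_of_equilateral {a b c : ℝ} (hb : 0 < b) (ha : a = 2 * b) (hb2 : 3 * b ^ 2 = 1)
    (hc : c ^ 2 ≤ b ^ 2) : (a, b, c) ∈ C1 ∪ C2 ∪ C3 ∪ {P1, P2, P3} := by
  obtain rfl := eq_one_div_sqrt_three hb hb2
  have ha' : a = 2 / √3 := by rw [ha]; ring
  subst ha'
  rcases hc.lt_or_eq with hlt | heq
  · obtain ⟨h1, h2⟩ := abs_lt_one_div_sqrt_three (c := c) (by linarith)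
    exact Or.inl (Or.inl (Or.inl ⟨c, h1, h2, rfl⟩))
  · rcases sq_eq_sq_iff_eq_or_eq_neg.1 heq with rfl | rfl
    · exact Or.inr (Or.inl rfl)
    · refine Or.inr (Or.inr (Or.inl ?_))
      rw [P2, neg_div]

/-- If a limit of points of `Ω` is a limit of other points of the surface, then one of the
inequalities that define `Ω` is an equality there. The Dziobek polynomial then factorizes, which
leaves only the three curves and their end points. -/
lemma relBoundary_subset :
    relBoundary dziobekSurface Omega ⊆ C1 ∪ C2 ∪ C3 ∪ {P1, P2, P3} := by
  rintro ⟨a, b, c⟩ h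
  obtain ⟨hD, hcl, hcl'⟩ := mem_relBoundary_iff.1 h
  obtain ⟨h1, h2, h3, h4, h5, h6, h7⟩ :=
    le_of_mem_closure_Omega (closure_mono inter_subset_right hcl)
  have hD : dziobek (position (a, b, c)) = 0 := hD
  rw [dziobek_position] at hD
  have hb : 0 < b := by
    by_contra! hle
    nlinarith [mul_nonneg (show 0 ≤ a by linarith) (neg_nonneg.2 hle)]
  have habc : b + c ≤ a := by
    by_contra! hlt
    nlinarith [mul_pos (sub_pos.2 hlt) (show 0 < a - c + b by linarith)]
  rcases h4.eq_or_lt with h4 | h4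
  · -- `r₁₃ = r₁₂`: the triangle `q₁ q₂ q₃` is equilateral
    have hab : b < a := by nlinarith
    have hlt : (b - c) ^ 2 < 1 + (a - c) ^ 2 := by
      rcases lt_or_ge c 0 with hc | hc
      · have : b ^ 2 < (a - c) ^ 2 := pow_lt_pow_left₀ (by linarith) hb.le (by norm_num)
        nlinarith
      · nlinarith
    rw [← h4, dziobekPoly_of_eq_12_13, neg_eq_zero, mul_eq_zero, mul_eq_zero, sub_eq_zero,
      sub_eq_zero, sub_eq_zero, cubeOfSq_inj (by positivity) (by positivity),
      cubeOfSq_inj (by positivity) (by positivity),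
      cubeOfSq_inj (by positivity) (by positivity)] at hD
    have h5' : a ^ 2 = 1 + (a - b) ^ 2 := by
      rcases hD with (hD | hD) | hD
      · linarith
      · linarith
      · exact hD
    have ha : a = 2 * b := by
      have : a * (a - 2 * b) = 0 := by linarith
      linarith [(mul_eq_zero.1 this).resolve_left (by linarith)]
    subst ha
    exact mem_of_equilateral hb rfl (by linarith) (by linarith)
  rcases h3.eq_or_lt with h3 | h3
  · -- `r₂₄ = r₁₃`: an isosceles trapezoid
    have ha : a = b + c := by
      rcases sq_eq_sq_iff_eq_or_eq_neg.1 h3 with h | h <;> linarith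
    subst ha
    have hc : 0 ≤ c := by
      by_contra! hlt
      nlinarith
    rcases hc.eq_or_lt with rfl | hc
    · have hb1 : b = 1 := by nlinarith
      subst hb1
      refine Or.inr (Or.inr (Or.inr ?_))
      simp [P3]
    have hcb : c < b := lt_of_le_of_ne h2 (by rintro rfl; linarith)
    have hc3 : 3 * c ^ 2 < 1 := by nlinarith
    rw [← dziobek_position, dziobek_isosceles (by linarith) h2, neg_eq_zero] at hD
    refine Or.inl (Or.inr ⟨b + c, b, c, rfl, (mul_eq_zero.1 hD).resolve_left ?_, hc,
      (abs_lt_one_div_sqrt_three hc3).2, rfl⟩)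
    exact (sub_pos.2 (cubeOfSq_lt (by positivity) (by nlinarith))).ne'
  rcases h5.eq_or_lt with h5 | h5
  · -- `r₁₂ = r₂₃`: a rhombus
    rw [h5, dziobekPoly_of_eq_12_23, mul_eq_zero, mul_eq_zero, sub_eq_zero, sub_eq_zero,
      sub_eq_zero, cubeOfSq_inj (by positivity) (by positivity),
      cubeOfSq_inj (by positivity) (by positivity),
      cubeOfSq_inj (by positivity) (by positivity)] at hD
    have h7' : 1 + c ^ 2 = (b - c) ^ 2 := by
      rcases hD with (hD | hD) | hD
      · linarith
      · linarith
      · exact hD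
    have hba : b = c + a := by
      have : b * (b - (c + a)) = 0 := by linarith
      linarith [(mul_eq_zero.1 this).resolve_left hb.ne']
    have hc : c < 0 := by
      by_contra! hle
      have : b + c = a := by linarith
      have : c = 0 := by linarith
      subst this
      rw [hba] at h3
      simp at h3
    have ha2 : a ^ 2 = 1 + c ^ 2 := by rw [← h5, hba]; ring
    have hc3 : 3 * c ^ 2 < 1 := by nlinarith
    have has : a = √(1 + c ^ 2) := by rw [← ha2, Real.sqrt_sq (by linarith)]
    refine Or.inl (Or.inl (Or.inr ⟨c, (abs_lt_one_div_sqrt_three hc3).1, hc, ?_⟩))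
    rw [hba, ← has]
  exfalso
  rcases h6.eq_or_lt with h6 | h6
  · rcases sq_eq_sq_iff_eq_or_eq_neg.1 h6 with h | h
    · exact h3.ne (by rw [h]; ring)
    · have : a = b - c := by linarith
      rw [this] at h5
      nlinarith
  rcases h7.eq_or_lt with h7 | h7
  · rw [h7, dziobekPoly_of_eq_14_34, mul_eq_zero, mul_eq_zero, sub_eq_zero, sub_eq_zero,
      sub_eq_zero, cubeOfSq_inj (by positivity) (by positivity),
      cubeOfSq_inj (by positivity) (by positivity),
      cubeOfSq_inj (by positivity) (by positivity)] at hD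
    rcases hD with (hD | hD) | hD <;> linarith
  rcases h1.eq_or_lt with rfl | h1
  · linarith [sq_nonneg (1 - b)]
  rcases h2.eq_or_lt with rfl | h2
  · linarith
  exact not_mem_closure_sdiff_of_lt h1 h2 h3 h4 h5 h6 h7 hcl'

/-- Each point for which `q₁ q₂ q₃` is equilateral is in the surface, but not in `Ω`. -/
lemma mem_surface_sdiff_of_equilateral {b c : ℝ} (hb2 : 3 * b ^ 2 = 1) :
    (2 * b, b, c) ∈ dziobekSurface \ Omega := by
  refine ⟨?_, fun h => ?_⟩
  · change dziobek _ = 0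
    rw [dziobek_position, show (2 * b) ^ 2 = 1 + b ^ 2 by linarith,
      show 1 + (2 * b - b) ^ 2 = 1 + b ^ 2 by ring, dziobekPoly_of_eq_12_13]
    ring
  · obtain ⟨-, -, -, -, h, -⟩ := (mem_Omega_iff _ _ _).1 h
    linarith

lemma two_div_sqrt_three : (2 / √3 : ℝ) = 2 * (1 / √3) := by ring

lemma three_mul_one_div_sqrt_three_sq : 3 * (1 / √3) ^ 2 = 1 := by
  rw [div_pow, Real.sq_sqrt (by norm_num)]; norm_num

lemma mem_relBoundary_of_equilateral {c : ℝ} (h1 : -1 / √3 ≤ c) (h2 : c ≤ 1 / √3) :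
    (2 / √3, 1 / √3, c) ∈ relBoundary dziobekSurface Omega := by
  have hb := three_mul_one_div_sqrt_three_sq
  have hb0 : 0 < 1 / √3 := by positivity
  rw [neg_div] at h1
  rw [two_div_sqrt_three]
  generalize (1 / √3 : ℝ) = b at *
  have hmem := mem_surface_sdiff_of_equilateral (c := c) hb
  refine mem_relBoundary_iff.2 ⟨hmem.1, ?_, subset_closure hmem⟩
  rw [inter_eq_self_of_subset_right Omega_subset_surface]
  -- the end points of the segment are limits of its interior points
  have hc : c ∈ closure (Ioo (-b) b) := by rw [closure_Ioo (by linarith)]; exact ⟨h1, h2⟩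
  exact closure_closure (s := Omega) ▸ map_mem_closure (f := fun x => (2 * b, b, x))
    (by fun_prop) hc fun x hx => mem_closure_Omega_of_equilateral hb0 hb rfl hx.1 hx.2

lemma mem_Omega_of_C2 {c : ℝ} (h1 : -1 / √3 < c) (h2 : c ≤ 0) :
    (√(1 + c ^ 2), c + √(1 + c ^ 2), c) ∈ Omega :=
  mem_Omega_of_rhombus (Real.one_le_sqrt.2 (by nlinarith)) rfl (Real.sq_sqrt (by positivity)) h2
    (three_mul_sq_lt_one h1 (h2.trans_lt (by positivity)))

lemma mem_relBoundary_of_C2 {c : ℝ} (h1 : -1 / √3 < c) (h2 : c ≤ 0) :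
    (√(1 + c ^ 2), c + √(1 + c ^ 2), c) ∈ relBoundary dziobekSurface Omega := by
  have hmem := mem_Omega_of_C2 h1 h2
  exact mem_relBoundary_iff.2 ⟨Omega_subset_surface hmem,
    subset_closure ⟨Omega_subset_surface hmem, hmem⟩,
    mem_closure_sdiff_of_rhombus (Real.one_le_sqrt.2 (by nlinarith)) rfl
      (Real.sq_sqrt (by positivity)) h2 (three_mul_sq_lt_one h1 (h2.trans_lt (by positivity)))⟩

lemma isosRegion_of_C3 {b c : ℝ} (h0 : f b c = 0) (h1 : 0 < c) (h2 : c < 1 / √3) :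
    IsosRegion b c :=
  isosRegion_of_f_eq_zero h1
    (three_mul_sq_lt_one (lt_trans (by rw [neg_div, neg_lt_zero]; positivity) h1) h2) h0

lemma P3_eq : P3 = (√(1 + 0 ^ 2), 0 + √(1 + 0 ^ 2), 0) := by simp [P3]

theorem relBoundary_Omega :
    relBoundary dziobekSurface Omega = C1 ∪ C2 ∪ C3 ∪ {P1, P2, P3} := by
  refine relBoundary_subset.antisymm ?_
  have h3 : 0 < 1 / √3 := by positivity
  have h3' : -1 / √3 < 0 := by rw [neg_div]; linarith
  rintro p (((⟨c, h1, h2, rfl⟩ | ⟨c, h1, h2, rfl⟩) | ⟨a, b, c, rfl, h0, h1, h2, rfl⟩) | rfl | rfl | rfl)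
  · exact mem_relBoundary_of_equilateral h1.le h2.le
  · exact mem_relBoundary_of_C2 h1 h2.le
  · have hr := isosRegion_of_C3 h0 h1 h2
    have hmem := hr.mem_Omega h0
    exact mem_relBoundary_iff.2 ⟨Omega_subset_surface hmem,
      subset_closure ⟨Omega_subset_surface hmem, hmem⟩, mem_closure_sdiff_of_isosceles hr h1 h0⟩
  · exact mem_relBoundary_of_equilateral (by linarith) le_rfl
  · exact mem_relBoundary_of_equilateral le_rfl (by linarith)
  · rw [P3_eq]
    exact mem_relBoundary_of_C2 h3' le_rfl

/-! ### Configurations on the boundary -/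

lemma exists_masses_of_mem_Omega {p : ℝ × ℝ × ℝ} (h : p ∈ Omega) :
    ∃ m : Fin 4 → ℝ, m 0 = 1 ∧ IsCentral m (position p) :=
  (Omega_subset_realizable h).2.2.2

lemma isRhombus_position {a c : ℝ} (ha : 0 < a) (hac : a ^ 2 = 1 + c ^ 2) :
    IsRhombus (position (a, c + a, c)) := by
  refine ⟨position_injective ha.ne' (by linarith), ?_, ?_, ?_⟩
  · rw [dist_position_01, dist_position_12, hac]; ring_nf
  · rw [dist_position_12, dist_position_23]; congr 1; linear_combination -hac
  · rw [dist_position_23, dist_comm, dist_position_03, ← hac]; ring_nf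

lemma not_collinear_of_cross_ne_zero {x y z : Plane} (h : cross (y - x) (z - x) ≠ 0) :
    ¬ Collinear ℝ {x, y, z} := by
  intro hcol
  obtain ⟨v, hv⟩ := (collinear_iff_of_mem (p₀ := x) (by simp)).1 hcol
  obtain ⟨r, hr⟩ := hv y (by simp)
  obtain ⟨s, hs⟩ := hv z (by simp)
  apply h
  subst hr hs
  simp [cross]
  ring

lemma IsosRegion.isIsoscelesTrapezoid {b c : ℝ} (h : IsosRegion b c) (hc : 0 < c) :
    IsIsoscelesTrapezoid (position (b + c, b, c)) := by
  have hlt := h.lt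
  have hd : 0 < b - c := by linarith
  refine ⟨not_collinear_of_cross_ne_zero (by rw [cross_position]; linarith),
    ⟨(b + c) / (b - c), ?_, ?_⟩, ?_⟩
  · rw [one_lt_div hd]; linarith
  · rw [position_sub _ _ _ (by linarith), smul_smul, div_mul_div_cancel₀ hd.ne',
      div_self (by linarith), one_smul]
  · rw [dist_position_12, dist_position_03]; ring_nf

lemma firstThreeEquilateral_position {b c : ℝ} (hb : 0 < b) (hb2 : 3 * b ^ 2 = 1) :
    FirstThreeEquilateral (position (2 * b, b, c)) := by
  refine ⟨?_, ?_, ?_⟩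
  · rw [← dist_pos, dist_position_01]; positivity
  · rw [dist_position_01, dist_position_12]; congr 1; linear_combination hb2
  · rw [dist_position_12, dist_position_02]; ring_nf

/-- If `q₁ q₂ q₃` is equilateral and the fourth mass is zero, then with the inverse cube of the side
as the multiplier only the equations of the fourth body remain. -/
lemma centralEquations_of_equilateral {m : Fin 4 → ℝ} {q : Fin 4 → Plane} {τ : ℝ}
    (h : FirstThreeEquilateral q) (hq : q 2 - q 3 = τ • (q 1 - q 0)) (hM : 0 < ∑ i, m i)
    (hm : m 3 = 0)
    (h1 : m 0 * strength (dist (q 0) (q 1) ^ 3)⁻¹ q 0 3 +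
      m 1 * strength (dist (q 0) (q 1) ^ 3)⁻¹ q 1 3 = 0)
    (h2 : m 1 * strength (dist (q 0) (q 1) ^ 3)⁻¹ q 1 3 +
      τ * (m 2 * strength (dist (q 0) (q 1) ^ 3)⁻¹ q 2 3) = 0) :
    CentralEquations m q := by
  obtain ⟨hne, e1, e2⟩ := h
  have hpos := dist_pos.2 hne
  refine centralEquations_of_scalarEquations hq hM (k := (dist (q 0) (q 1) ^ 3)⁻¹)
    (by positivity) ?_
  have s01 : strength (dist (q 0) (q 1) ^ 3)⁻¹ q 0 1 = 0 := sub_self _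
  have s12 : strength (dist (q 0) (q 1) ^ 3)⁻¹ q 1 2 = 0 := by rw [strength, e1, sub_self]
  have s02 : strength (dist (q 0) (q 1) ^ 3)⁻¹ q 0 2 = 0 := by rw [strength, e1, e2, sub_self]
  exact ⟨by simp [s02, hm], by simp [s01, s02], by simp [s12, hm], by simp [s01, s12],
    by simp [s02, s12], by simp [s12, hm], h1, h2⟩

lemma exists_masses_of_equilateral {b c : ℝ} (hb : 0 < b) (hb2 : 3 * b ^ 2 = 1)
    (h1 : -b < c) (h2 : c < b) :
    ∃ m : Fin 4 → ℝ, m 0 = 1 ∧ 0 < m 1 ∧ 0 < m 2 ∧ m 3 = 0 ∧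
      IsRestrictedCentral m (position (2 * b, b, c)) := by
  have heq := firstThreeEquilateral_position (c := c) hb hb2
  have hsub := position_sub (2 * b) b c (by positivity)
  have hinj := position_injective (a := 2 * b) (by positivity) h2.ne'
  have hτ : 0 < (b - c) / (2 * b) := div_pos (by linarith) (by positivity)
  have l03 : dist (position (2 * b, b, c) 0) (position (2 * b, b, c) 3) <
      dist (position (2 * b, b, c) 0) (position (2 * b, b, c) 1) := by
    rw [dist_position_01, dist_position_03]
    exact Real.sqrt_lt_sqrt (by positivity) (by nlinarith)
  have l13 : dist (position (2 * b, b, c) 0) (position (2 * b, b, c) 1) <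
      dist (position (2 * b, b, c) 1) (position (2 * b, b, c) 3) := by
    rw [dist_position_01, dist_position_13]
    exact Real.sqrt_lt_sqrt (by positivity) (by nlinarith)
  have l23 : dist (position (2 * b, b, c) 2) (position (2 * b, b, c) 3) <
      dist (position (2 * b, b, c) 0) (position (2 * b, b, c) 1) := by
    rw [dist_position_01, dist_position_23]
    exact Real.sqrt_lt_sqrt (by positivity) (by nlinarith)
  have p01 := dist_pos.2 (hinj.ne (show (0 : Fin 4) ≠ 1 by decide))
  have p03 := dist_pos.2 (hinj.ne (show (0 : Fin 4) ≠ 3 by decide))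
  have p23 := dist_pos.2 (hinj.ne (show (2 : Fin 4) ≠ 3 by decide))
  set q := position (2 * b, b, c)
  set k := (dist (q 0) (q 1) ^ 3)⁻¹ with hk
  set τ := (b - c) / (2 * b)
  have s03 : 0 < strength k q 0 3 := sub_pos.2
    (inv_strictAnti₀ (by positivity) (pow_lt_pow_left₀ l03 p03.le (by norm_num)))
  have s13 : 0 < -strength k q 1 3 := neg_pos.2 (sub_neg.2
    (inv_strictAnti₀ (by positivity) (pow_lt_pow_left₀ l13 p01.le (by norm_num))))
  have s23 : 0 < strength k q 2 3 := sub_pos.2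
    (inv_strictAnti₀ (by positivity) (pow_lt_pow_left₀ l23 p23.le (by norm_num)))
  have m1 : 0 < strength k q 0 3 / -strength k q 1 3 := by positivity
  have m2 : 0 < strength k q 0 3 / (τ * strength k q 2 3) := by positivity
  refine ⟨![1, strength k q 0 3 / -strength k q 1 3, strength k q 0 3 / (τ * strength k q 2 3), 0],
    rfl, m1, m2, rfl, ?_, ⟨0, one_pos⟩, ⟨3, rfl⟩, fun i j hij h => (hij (hinj h)).elim, ?_⟩
  · intro i
    fin_cases i
    exacts [zero_le_one, m1.le, m2.le, le_rfl]
  · have s13' : strength k q 1 3 ≠ 0 := by linarith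
    refine centralEquations_of_equilateral heq hsub ?_ rfl ?_ ?_
    · simp only [Fin.sum_univ_four]
      change 0 < 1 + strength k q 0 3 / -strength k q 1 3 +
        strength k q 0 3 / (τ * strength k q 2 3) + 0
      linarith
    · simp [← hk]
      field_simp
      ring
    · simp [← hk]
      field_simp
      ring

lemma exists_masses_of_equilateral_collision {b : ℝ} (hb : 0 < b) (hb2 : 3 * b ^ 2 = 1) :
    ∃ m : Fin 4 → ℝ, m 0 = 1 ∧ 0 < m 1 ∧ m 2 = 0 ∧ m 3 = 0 ∧
      IsRestrictedCentral m (position (2 * b, b, b)) := by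
  have heq := firstThreeEquilateral_position (c := b) hb hb2
  have hsub := position_sub (2 * b) b b (by positivity)
  have e3 : position (2 * b, b, b) 3 = position (2 * b, b, b) 2 := rfl
  refine ⟨![1, 1, 0, 0], rfl, one_pos, rfl, rfl, ?_, ⟨0, one_pos⟩, ⟨3, rfl⟩, ?_, ?_⟩
  · intro i
    fin_cases i
    exacts [zero_le_one, zero_le_one, le_rfl, le_rfl]
  · intro i j hij h
    have h0 := congrArg (fun x : Plane => x 0) h
    have h1 := congrArg (fun x : Plane => x 1) h
    have := hb.ne'
    fin_cases i <;> fin_cases j <;> simp_all [position]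
  · refine centralEquations_of_equilateral heq hsub (by simp [Fin.sum_univ_four]) rfl ?_ ?_
    · simp [strength, e3, ← heq.2.1, ← heq.2.2]
    · simp [strength, e3, ← heq.2.1]

lemma exists_masses_of_equilateral_rhombus {b : ℝ} (hb : 0 < b) (hb2 : 3 * b ^ 2 = 1) :
    ∃ m : Fin 4 → ℝ, m 0 = 1 ∧ m 1 = 0 ∧ 0 < m 2 ∧ m 3 = 0 ∧
      IsRestrictedCentral m (position (2 * b, b, -b)) := by
  have heq := firstThreeEquilateral_position (c := -b) hb hb2
  have hsub := position_sub (2 * b) b (-b) (by positivity)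
  have hinj := position_injective (a := 2 * b) (b := b) (c := -b) (by positivity) (by linarith)
  refine ⟨![1, 0, 1, 0], rfl, rfl, one_pos, rfl, ?_, ⟨0, one_pos⟩, ⟨3, rfl⟩,
    fun i j hij h => (hij (hinj h)).elim, ?_⟩
  · intro i
    fin_cases i
    exacts [zero_le_one, le_rfl, zero_le_one, le_rfl]
  · have e1 : 1 + b ^ 2 = (2 * b) ^ 2 := by linarith
    have e2 : (b - -b) ^ 2 = (2 * b) ^ 2 := by ring
    refine centralEquations_of_equilateral heq hsub (by simp [Fin.sum_univ_four]) rfl ?_ ?_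
    · simp [strength, dist_position_01, dist_position_03, e1]
    · simp only [strength, dist_position_01, dist_position_23, e2]
      simp

theorem equilateral_of_mem_C1 {p : ℝ × ℝ × ℝ} (hp : p ∈ C1) : FirstThreeEquilateral (position p) ∧
    ∃ m : Fin 4 → ℝ, m 0 = 1 ∧ 0 < m 1 ∧ 0 < m 2 ∧ m 3 = 0 ∧
      IsRestrictedCentral m (position p) := by
  obtain ⟨c, h1, h2, rfl⟩ := hp
  rw [neg_div] at h1
  rw [two_div_sqrt_three]
  have hb := three_mul_one_div_sqrt_three_sq
  exact ⟨firstThreeEquilateral_position (by positivity) hb,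
    exists_masses_of_equilateral (by positivity) hb h1 h2⟩

theorem isRhombus_of_mem_C2 {p : ℝ × ℝ × ℝ} (hp : p ∈ C2) : IsRhombus (position p) ∧
    ∃ m : Fin 4 → ℝ, m 0 = 1 ∧ IsCentral m (position p) := by
  obtain ⟨c, h1, h2, rfl⟩ := hp
  exact ⟨isRhombus_position (Real.sqrt_pos.2 (by positivity)) (Real.sq_sqrt (by positivity)),
    exists_masses_of_mem_Omega (mem_Omega_of_C2 h1 h2.le)⟩

theorem isIsoscelesTrapezoid_of_mem_C3 {p : ℝ × ℝ × ℝ} (hp : p ∈ C3) :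
    IsIsoscelesTrapezoid (position p) ∧
      ∃ m : Fin 4 → ℝ, m 0 = 1 ∧ IsCentral m (position p) := by
  obtain ⟨a, b, c, rfl, h0, h1, h2, rfl⟩ := hp
  have hr := isosRegion_of_C3 h0 h1 h2
  exact ⟨hr.isIsoscelesTrapezoid h1, exists_masses_of_mem_Omega (hr.mem_Omega h0)⟩

theorem equilateral_collision_P1 : FirstThreeEquilateral (position P1) ∧
    position P1 2 = position P1 3 ∧
      ∃ m : Fin 4 → ℝ, m 0 = 1 ∧ 0 < m 1 ∧ m 2 = 0 ∧ m 3 = 0 ∧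
        IsRestrictedCentral m (position P1) := by
  rw [P1, two_div_sqrt_three]
  have hb := three_mul_one_div_sqrt_three_sq
  exact ⟨firstThreeEquilateral_position (by positivity) hb, rfl,
    exists_masses_of_equilateral_collision (by positivity) hb⟩

theorem equilateral_rhombus_P2 : IsRhombus (position P2) ∧ FirstThreeEquilateral (position P2) ∧
    ∃ m : Fin 4 → ℝ, m 0 = 1 ∧ m 1 = 0 ∧ 0 < m 2 ∧ m 3 = 0 ∧
      IsRestrictedCentral m (position P2) := by
  rw [P2, two_div_sqrt_three, neg_div]
  have hb := three_mul_one_div_sqrt_three_sq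
  refine ⟨?_, firstThreeEquilateral_position (by positivity) hb,
    exists_masses_of_equilateral_rhombus (by positivity) hb⟩
  have := isRhombus_position (a := 2 * (1 / √3)) (c := -(1 / √3)) (by positivity) (by linarith)
  rwa [show -(1 / √3) + 2 * (1 / √3) = 1 / √3 by ring] at this

theorem square_P3 : IsSquareConfig (position P3) ∧
    ∃ m : Fin 4 → ℝ, m 0 = 1 ∧ IsCentral m (position P3) := by
  have h3 : -1 / √3 < 0 := div_neg_of_neg_of_pos (by norm_num) (by positivity)
  refine ⟨⟨?_, ?_⟩, ?_⟩
  · simpa [P3] using isRhombus_position (a := 1) (c := 0) one_pos (by norm_num)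
  · rw [P3, dist_position_02, dist_position_13]; norm_num
  · rw [P3_eq]
    exact exists_masses_of_mem_Omega (mem_Omega_of_C2 h3 le_rfl)

end TrapezoidCC

theorem mainTheorem1 :
    -- the realizable central configurations are exactly the points of `Ω`
    TrapezoidCC.Realizable = TrapezoidCC.Omega ∧
    -- up to relabelling and similarity, every trapezoid central configuration is in `Ω`
    (∀ (m : Fin 4 → ℝ) (q : Fin 4 → TrapezoidCC.Plane),
      TrapezoidCC.IsTrapezoid q → TrapezoidCC.IsCentral m q →
        ∃ σ : Equiv.Perm (Fin 4), ∃ p ∈ TrapezoidCC.Omega,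
          Similar (q ∘ σ) (TrapezoidCC.position p)) ∧
    -- the boundary of `Ω` in the surface `D = 0`
    TrapezoidCC.relBoundary TrapezoidCC.dziobekSurface TrapezoidCC.Omega =
      TrapezoidCC.C1 ∪ TrapezoidCC.C2 ∪ TrapezoidCC.C3 ∪
        {TrapezoidCC.P1, TrapezoidCC.P2, TrapezoidCC.P3} ∧
    -- restricted problem, equilateral triangle
    (∀ p ∈ TrapezoidCC.C1, TrapezoidCC.FirstThreeEquilateral (TrapezoidCC.position p) ∧
      ∃ m : Fin 4 → ℝ, m 0 = 1 ∧ 0 < m 1 ∧ 0 < m 2 ∧ m 3 = 0 ∧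
        TrapezoidCC.IsRestrictedCentral m (TrapezoidCC.position p)) ∧
    -- rhombi
    (∀ p ∈ TrapezoidCC.C2, TrapezoidCC.IsRhombus (TrapezoidCC.position p) ∧
      ∃ m : Fin 4 → ℝ, m 0 = 1 ∧ TrapezoidCC.IsCentral m (TrapezoidCC.position p)) ∧
    -- isosceles trapezoids
    (∀ p ∈ TrapezoidCC.C3, TrapezoidCC.IsIsoscelesTrapezoid (TrapezoidCC.position p) ∧
      ∃ m : Fin 4 → ℝ, m 0 = 1 ∧ TrapezoidCC.IsCentral m (TrapezoidCC.position p)) ∧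
    -- equilateral triangle with a collision of the massless bodies 3 and 4
    (TrapezoidCC.FirstThreeEquilateral (TrapezoidCC.position TrapezoidCC.P1) ∧
      TrapezoidCC.position TrapezoidCC.P1 2 = TrapezoidCC.position TrapezoidCC.P1 3 ∧
      ∃ m : Fin 4 → ℝ, m 0 = 1 ∧ 0 < m 1 ∧ m 2 = 0 ∧ m 3 = 0 ∧
        TrapezoidCC.IsRestrictedCentral m (TrapezoidCC.position TrapezoidCC.P1)) ∧
    -- restricted rhombus
    (TrapezoidCC.IsRhombus (TrapezoidCC.position TrapezoidCC.P2) ∧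
      TrapezoidCC.FirstThreeEquilateral (TrapezoidCC.position TrapezoidCC.P2) ∧
      ∃ m : Fin 4 → ℝ, m 0 = 1 ∧ m 1 = 0 ∧ 0 < m 2 ∧ m 3 = 0 ∧
        TrapezoidCC.IsRestrictedCentral m (TrapezoidCC.position TrapezoidCC.P2)) ∧
    -- square
    (TrapezoidCC.IsSquareConfig (TrapezoidCC.position TrapezoidCC.P3) ∧
      ∃ m : Fin 4 → ℝ, m 0 = 1 ∧
        TrapezoidCC.IsCentral m (TrapezoidCC.position TrapezoidCC.P3)) :=
  ⟨TrapezoidCC.realizable_eq_Omega, fun _ _ hq hc => hc.exists_similar_of_isTrapezoid hq,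
    TrapezoidCC.relBoundary_Omega, fun _ => TrapezoidCC.equilateral_of_mem_C1,
    fun _ => TrapezoidCC.isRhombus_of_mem_C2, fun _ => TrapezoidCC.isIsoscelesTrapezoid_of_mem_C3,
    TrapezoidCC.equilateral_collision_P1, TrapezoidCC.equilateral_rhombus_P2,
    TrapezoidCC.square_P3⟩
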